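/- Let $I=[0,1]$ and let $C(I)$ be the space of continuous functions $f\colon I\to\mathbb{R}$ with the supremum norm. A subset of a topological space is \emph{residual} if its complement is a countable union of nowhere dense sets. The Dini derivatives of $f$ are the extended real numbers \[ D^{+}f(x)=\limsup_{y\downarrow x}\frac{f(y)-f(x)}{y-x},\quad D_{+}f(x)=\liminf_{y\downarrow x}\frac{f(y)-f(x)}{y-x}\qquad(0\le x<1), \] \[ D^{-}f(x)=\limsup_{y\uparrow x}\frac{f(y)-f(x)}{y-x},\quad D_{-}f(x)=\liminf_{y\uparrow x}\frac{f(y)-f(x)}{y-x}\qquad(0<x\le 1). \] A point $x\in I$ is a \emph{knot point} of $f$ if either $x\in(0,1)$, $D^+f(x)=D^-f(x)=\infty$ and $D_+f(x)=D_-f(x)=-\infty$; or $x=0$, $D^+f(x)=\infty$ and $D_+f(x)=-\infty$; or $x=1$, $D^-f(x)=\infty$ and $D_-f(x)=-\infty$. Let $N(f)$ be the set of all points of $I$ that are not knot points of $f$. Let $\mathcal{K}$ be the set of all closed subsets of $I$ (including $\emptyset$) with the Hausdorff metric, where the distance from $\emptyset$ to every nonempty closed set is defined to be $1$, and give the set $\mathcal{K}^{\mathbb{N}}$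 of sequences in $\mathcal{K}$ the product topology. Let $\mathcal{F}_\sigma$ be the family of all $F_\sigma$ subsets of $I$. A subfamily $\mathcal{F}\subset\mathcal{F}_\sigma$ is called \emph{residual in $\mathcal{F}_\sigma$} if $\{(K_n)\in\mathcal{K}^{\mathbb{N}} : \bigcup_n K_n\in\mathcal{F}\}$ is residual in $\mathcal{K}^{\mathbb{N}}$. \textbf{Theorem.} For every family $\mathcal{S}$ of subsets of $I$, the following are equivalent: \begin{enumerate} \item the set $\{f\in C(I) : N(f)\in\mathcal{S}\}$ is residual in $C(I)$; \item $\mathcal{S}\cap\mathcal{F}_\sigma$ is residual in $\mathcal{F}_\sigma$. \end{enumerate} -/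

import Mathlib

open Filter Topology TopologicalSpace

noncomputable section

namespace KnotPoints

/-- The unit interval `[0,1]`. -/
abbrev I : Type := unitInterval

/-- The difference quotient `(f y - f x) / (y - x)`, as an extended real number. -/
def diffQuot (f : C(I, ℝ)) (x y : I) : EReal :=
  (((f y - f x) / ((y : ℝ) - (x : ℝ)) : ℝ) : EReal)

/-- Upper right Dini derivative `D^+ f(x)` (meaningful for `x < 1`). -/
def diniUpperRight (f : C(I, ℝ)) (x : I) : EReal :=
  limsup (fun y : I => diffQuot f x y) (𝓝[>] x)

/-- Lower right Dini derivative `D_+ f(x)` (meaningful for `x < 1`). -/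
def diniLowerRight (f : C(I, ℝ)) (x : I) : EReal :=
  liminf (fun y : I => diffQuot f x y) (𝓝[>] x)

/-- Upper left Dini derivative `D^- f(x)` (meaningful for `0 < x`). -/
def diniUpperLeft (f : C(I, ℝ)) (x : I) : EReal :=
  limsup (fun y : I => diffQuot f x y) (𝓝[<] x)

/-- Lower left Dini derivative `D_- f(x)` (meaningful for `0 < x`). -/
def diniLowerLeft (f : C(I, ℝ)) (x : I) : EReal :=
  liminf (fun y : I => diffQuot f x y) (𝓝[<] x)

/-- `x` is a knot point of `f`: every upper (lower) Dini derivative of `f` that is defined at `x`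
is `+∞` (`-∞`). -/
def IsKnotPoint (f : C(I, ℝ)) (x : I) : Prop :=
  (0 < x ∧ x < 1 ∧ diniUpperRight f x = ⊤ ∧ diniUpperLeft f x = ⊤ ∧
      diniLowerRight f x = ⊥ ∧ diniLowerLeft f x = ⊥) ∨
    (x = 0 ∧ diniUpperRight f x = ⊤ ∧ diniLowerRight f x = ⊥) ∨
    (x = 1 ∧ diniUpperLeft f x = ⊤ ∧ diniLowerLeft f x = ⊥)

/-- `N(f)`: the set of points of `[0,1]` that are not knot points of `f`. -/
def nonKnot (f : C(I, ℝ)) : Set I := {x | ¬ IsKnotPoint f x}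

/-- The family of all `F_σ` subsets of `[0,1]`. -/
def Fsigma : Set (Set I) := {A | ∃ K : ℕ → Closeds I, A = ⋃ n, (K n : Set I)}

/-- Residuality of a family `F` of `F_σ` sets: the sequences of closed sets whose union belongs to
`F` form a residual subset of the product space of sequences. `Closeds I` carries the topology of
the Hausdorff (extended) distance; `∅` is at distance `∞` from every nonempty closed set, which
induces the same topology as giving that distance the value `1`. -/
def ResidualFamily (F : Set (Set I)) : Prop :=
  {K : ℕ → Closeds I | (⋃ n, (K n : Set I)) ∈ F} ∈ residual (ℕ → Closeds I)

end KnotPoints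

end

/-!
The set `N(f)` is the increasing union of the closed sets of those points at which, on one side and
along a window of length `1/c`, the slopes of `f` are bounded above by `c` or below by `-c`. Two
players build `f` and `(K n)` simultaneously. A continuous function is perturbed by tall thin
spikes, of alternating signs, at the points of a fine grid: away from the spikes no slope bound
survives, and near the top of a spike one does precisely if the function stays below a steep line
on one side. So finitely many points can be prescribed near which all functions of a small ball
have bounded slopes, and conversely a family of spiked functions confines its points of bounded
slope to small balls. Labelling these balls by the indices of the closed sets, in such a way that
an index keeps essentially the same slope bound for the rest of the game, one gets
`N(f) = ⋃ n, K n` in the limit. As open sets of functions and open sets of sequences can be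
alternated, each player can also steer its object into a given dense `G_δ` set, as in the
Banach-Mazur game; this transfers residuality in both directions.
-/

namespace KnotPoints

/-! ### Slopes on one side of a point -/

section Signs

variable (σ : ℤˣ) (a b : ℝ)

lemma forall_units_iff {P : ℤˣ → Prop} : (∀ u, P u) ↔ P 1 ∧ P (-1) :=
  ⟨fun h => ⟨h 1, h (-1)⟩, fun h u => by
    rcases Int.units_eq_one_or u with rfl | rfl
    exacts [h.1, h.2]⟩

lemma coe_units_mul_self : (σ : ℝ) * σ = 1 := by
  rcases Int.units_eq_one_or σ with rfl | rfl <;> simp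

lemma abs_units_mul : |(σ : ℝ) * a| = |a| := by
  rcases Int.units_eq_one_or σ with rfl | rfl <;> simp

lemma abs_units_mul_sub_mul : |(σ : ℝ) * a - σ * b| = |a - b| := by
  rw [← mul_sub, abs_units_mul]

end Signs

/-- The signed distance from `x` to `y` when moving in the direction `d = ±1`. -/
def ahead (d : ℤˣ) (x y : I) : ℝ := d * (y - x)

/-- Moving from `x` by `w` in the direction `d = ±1` does not leave the unit interval. -/
def HasRoom (d : ℤˣ) (w : ℝ) (x : I) : Prop := (x : ℝ) + d * w ∈ Set.Icc (0 : ℝ) 1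

section OneSided

variable {d : ℤˣ} {x y z : I} {w w' : ℝ}

@[simp]
lemma ahead_self (d : ℤˣ) (x : I) : ahead d x x = 0 := by simp [ahead]

lemma ahead_add (d : ℤˣ) (x y z : I) : ahead d x y + ahead d y z = ahead d x z := by
  simp only [ahead]; ring

lemma abs_ahead (d : ℤˣ) (x y : I) : |ahead d x y| = dist x y := by
  rw [ahead, abs_units_mul, abs_sub_comm, Subtype.dist_eq, Real.dist_eq]

@[fun_prop]
lemma continuous_ahead (d : ℤˣ) {α : Type*} [TopologicalSpace α] {u v : α → I}
    (hu : Continuous u) (hv : Continuous v) : Continuous fun a => ahead d (u a) (v a) := by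
  unfold ahead; fun_prop

lemma HasRoom.mono (h : HasRoom d w x) (hw' : 0 ≤ w') (hle : ahead d x y + w' ≤ w) :
    HasRoom d w' y := by
  have hx := x.2
  have hy := y.2
  rcases Int.units_eq_one_or d with rfl | rfl <;>
    simp only [HasRoom, ahead, Set.mem_Icc, Units.val_one, Units.val_neg, Int.cast_one,
      Int.cast_neg] at h hle hx hy ⊢ <;>
    constructor <;> linarith

lemma exists_hasRoom (hw : 0 ≤ w) (hw' : w ≤ 1 / 2) (x : I) : ∃ d, HasRoom d w x := by
  have hx := x.2
  rcases le_total (x : ℝ) (1 / 2) with h | h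
  · refine ⟨1, ?_, ?_⟩ <;> push_cast <;> linarith [hx.1]
  · refine ⟨-1, ?_, ?_⟩ <;> push_cast <;> linarith [hx.2]

lemma HasRoom.exists_ahead_eq (h : HasRoom d w x) : ∃ y, ahead d x y = w :=
  ⟨⟨_, h⟩, by rcases Int.units_eq_one_or d with rfl | rfl <;> simp [ahead]⟩

lemma exists_pos_hasRoom_one : (∃ w > 0, HasRoom 1 w x) ↔ x < 1 := by
  constructor
  · rintro ⟨w, hw, h⟩
    have hx1 := h.2
    push_cast at hx1
    exact Subtype.coe_lt_coe.1 (show (x : ℝ) < 1 by linarith)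
  · intro h
    exact ⟨1 - x, sub_pos.2 (Subtype.coe_lt_coe.2 h), by simp [HasRoom]⟩

lemma exists_pos_hasRoom_neg_one : (∃ w > 0, HasRoom (-1) w x) ↔ 0 < x := by
  constructor
  · rintro ⟨w, hw, h⟩
    have hx0 := h.1
    push_cast at hx0
    exact Subtype.coe_lt_coe.1 (show (0 : ℝ) < x by linarith)
  · intro h
    exact ⟨x, Subtype.coe_lt_coe.2 h, by simp [HasRoom]⟩

end OneSided

/-- The points at which `f` (if `σ = 1`) or `-f` (if `σ = -1`) has slope at most `c` on the whole
window of length `c⁻¹` in the direction `d`; the window is required to lie in the unit interval. -/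
def slopeBoundedSide (σ d : ℤˣ) (c : ℝ) (f : C(I, ℝ)) : Set I :=
  {x | HasRoom d c⁻¹ x ∧
    ∀ y, 0 < ahead d x y → ahead d x y < c⁻¹ → σ * (f y - f x) ≤ c * ahead d x y}

/-- The points at which one of the four Dini derivatives is bounded by `c` on a window of length
`c⁻¹`. -/
def slopeBounded (c : ℝ) (f : C(I, ℝ)) : Set I := ⋃ (σ) (d), slopeBoundedSide σ d c f

section SlopeBounded

variable {σ d : ℤˣ} {c c' : ℝ} {f f' : C(I, ℝ)} {x p : I}

lemma mem_slopeBounded : x ∈ slopeBounded c f ↔ ∃ σ d, x ∈ slopeBoundedSide σ d c f := by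
  simp only [slopeBounded, Set.mem_iUnion]

lemma isClosed_slopeBoundedSide (σ d : ℤˣ) (c : ℝ) (f : C(I, ℝ)) :
    IsClosed (slopeBoundedSide σ d c f) := by
  have hroom : IsClosed {x : I | HasRoom d c⁻¹ x} :=
    isClosed_Icc.preimage (by fun_prop)
  have hwindow (y : I) : IsClosed {x : I | 0 < ahead d x y → ahead d x y < c⁻¹ →
      σ * (f y - f x) ≤ c * ahead d x y} := by
    simp only [← and_imp]
    have hopen : IsOpen {x | 0 < ahead d x y ∧ ahead d x y < c⁻¹} :=
      isOpen_Ioo.preimage (by fun_prop : Continuous fun x => ahead d x y)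
    exact isClosed_imp hopen (isClosed_le (by fun_prop) (by fun_prop))
  simpa only [slopeBoundedSide, Set.ofPred_and, Set.ofPred_forall]
    using hroom.inter (isClosed_iInter hwindow)

lemma isClosed_slopeBounded (c : ℝ) (f : C(I, ℝ)) : IsClosed (slopeBounded c f) :=
  isClosed_iUnion_of_finite fun _ => isClosed_iUnion_of_finite fun _ =>
    isClosed_slopeBoundedSide _ _ _ _

lemma slopeBoundedSide_mono (hc : 0 < c) (h : c ≤ c') :
    slopeBoundedSide σ d c f ⊆ slopeBoundedSide σ d c' f := by
  rintro x ⟨hx, hslope⟩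
  have hinv : c'⁻¹ ≤ c⁻¹ := inv_anti₀ hc h
  refine ⟨hx.mono (by have := hc.trans_le h; positivity) (by simpa using hinv), fun y h0 h1 => ?_⟩
  exact (hslope y h0 (h1.trans_le hinv)).trans (by gcongr)

lemma slopeBounded_mono (hc : 0 < c) (h : c ≤ c') : slopeBounded c f ⊆ slopeBounded c' f :=
  Set.iUnion₂_mono fun _ _ => slopeBoundedSide_mono hc h

/-- If `σ f` lies below the line of slope `c` through `p`, with a margin `μ` at distance at least
`δ` from `p`, then lowering that line until it touches `σ f'` from above on the window produces a
point near `p` at which the slope of `σ f'` is bounded by `c`. -/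
theorem exists_mem_slopeBoundedSide_near {w δ μ : ℝ} (hc : 0 < c) (hroom : HasRoom d w p)
    (hδ : 0 < δ) (hcw : c⁻¹ + δ ≤ w)
    (hf : ∀ y, δ ≤ ahead d p y → ahead d p y ≤ w → σ * f y ≤ σ * f p + c * ahead d p y - μ)
    (hff' : ∀ y, |f' y - f y| < μ / 2) :
    ∃ x ∈ slopeBoundedSide σ d c f', dist x p < δ := by
  have hc' : 0 < c⁻¹ := inv_pos.2 hc
  have hclose (y : I) : |σ * f' y - σ * f y| < μ / 2 := by
    rw [abs_units_mul_sub_mul]; exact hff' y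
  have hpwindow : p ∈ ahead d p ⁻¹' Set.Icc 0 w := by
    simp only [Set.mem_preimage, ahead_self, Set.mem_Icc]; constructor <;> linarith
  have hwindow : IsCompact (ahead d p ⁻¹' Set.Icc 0 w) :=
    (isClosed_Icc.preimage (by fun_prop : Continuous fun y => ahead d p y)).isCompact
  obtain ⟨x, ⟨hx0, hxw⟩, hmax⟩ := hwindow.exists_isMaxOn ⟨p, hpwindow⟩
    (f := fun y => σ * f' y - c * ahead d p y) (by fun_prop)
  rw [isMaxOn_iff] at hmax
  have hlt : ahead d p x < δ := by
    by_contra! hge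
    have hp := hmax p hpwindow
    simp only [ahead_self, mul_zero, sub_zero] at hp
    linarith [hf x hge hxw, abs_lt.1 (hclose x), abs_lt.1 (hclose p)]
  refine ⟨x, ⟨hroom.mono hc'.le (by linarith), fun y hy0 hy1 => ?_⟩, ?_⟩
  · have hadd := ahead_add d p x y
    have := hmax y ⟨by linarith, by linarith⟩
    simp only [← hadd] at this
    linarith
  · rwa [dist_comm, ← abs_ahead d, abs_of_nonneg hx0]

end SlopeBounded

/-! ### Dini derivatives -/

lemma limsup_coe_ne_top_iff {α : Type*} {l : Filter α} {u : α → ℝ} :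
    limsup (fun y => (u y : EReal)) l ≠ ⊤ ↔ ∃ m : ℕ, ∀ᶠ y in l, u y ≤ m := by
  constructor
  · intro h
    obtain ⟨a, ha, -⟩ := EReal.lt_iff_exists_real_btwn.1 (lt_top_iff_ne_top.2 h)
    obtain ⟨m, hm⟩ := exists_nat_ge a
    refine ⟨m, (eventually_lt_of_limsup_lt ha).mono fun y hy => ?_⟩
    exact (EReal.coe_lt_coe_iff.1 hy).le.trans hm
  · rintro ⟨m, hm⟩
    have hle : limsup (fun y => (u y : EReal)) l ≤ ((m : ℝ) : EReal) :=
      limsup_le_of_le (by isBoundedDefault) (hm.mono fun y hy => EReal.coe_le_coe_iff.2 hy)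
    exact (hle.trans_lt (EReal.coe_lt_top _)).ne

/-- The upper Dini derivative of `σ f` at `x` in the direction `d`, with respect to the distance
from `x`. Up to sign, these are the four Dini derivatives of `f`. -/
noncomputable def upperSlope (σ d : ℤˣ) (f : C(I, ℝ)) (x : I) : EReal :=
  limsup (fun y => ((σ * (f y - f x) / ahead d x y : ℝ) : EReal)) (𝓝[{y | 0 < ahead d x y}] x)

section Dini

variable (f : C(I, ℝ)) (x : I)

lemma setOf_ahead_one_pos : {y | 0 < ahead 1 x y} = Set.Ioi x := by
  ext y; simp [ahead]

lemma setOf_ahead_neg_one_pos : {y | 0 < ahead (-1) x y} = Set.Iio x := by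
  ext y; simp [ahead]

lemma diniUpperRight_eq : diniUpperRight f x = upperSlope 1 1 f x := by
  rw [upperSlope, setOf_ahead_one_pos]
  simp [diniUpperRight, diffQuot, ahead]

lemma diniUpperLeft_eq : diniUpperLeft f x = upperSlope (-1) (-1) f x := by
  rw [upperSlope, setOf_ahead_neg_one_pos]
  simp [diniUpperLeft, diffQuot, ahead, -neg_sub, neg_div_neg_eq]

lemma diniLowerRight_eq : diniLowerRight f x = -upperSlope (-1) 1 f x := by
  rw [upperSlope, ← EReal.liminf_neg, setOf_ahead_one_pos, diniLowerRight]
  congr 1 with y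
  simp [diffQuot, ahead, -neg_sub, neg_div]

lemma diniLowerLeft_eq : diniLowerLeft f x = -upperSlope 1 (-1) f x := by
  rw [upperSlope, ← EReal.liminf_neg, setOf_ahead_neg_one_pos, diniLowerLeft]
  congr 1 with y
  simp [diffQuot, ahead, -neg_sub, div_neg]

variable {f x}

lemma isKnotPoint_iff_upperSlope_eq_top :
    IsKnotPoint f x ↔ ∀ d, (∃ w > 0, HasRoom d w x) → ∀ σ, upperSlope σ d f x = ⊤ := by
  simp only [IsKnotPoint, diniUpperRight_eq, diniUpperLeft_eq, diniLowerRight_eq,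
    diniLowerLeft_eq, EReal.neg_eq_bot_iff, forall_units_iff, exists_pos_hasRoom_one,
    exists_pos_hasRoom_neg_one]
  rcases eq_or_ne x 0 with rfl | h0
  · simp [and_comm]
  rcases eq_or_ne x 1 with rfl | h1
  · simp [and_comm]
  simp only [h0, h1, unitInterval.pos_iff_ne_zero, unitInterval.lt_one_iff_ne_one, ne_eq,
    not_false_eq_true, forall_const, true_and, false_and, or_false]
  tauto

lemma upperSlope_ne_top_iff {σ d : ℤˣ} : upperSlope σ d f x ≠ ⊤ ↔
    ∃ m : ℕ, ∀ᶠ y in 𝓝[{y | 0 < ahead d x y}] x, σ * (f y - f x) ≤ m * ahead d x y := by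
  rw [upperSlope, limsup_coe_ne_top_iff]
  refine exists_congr fun m => eventually_congr (eventually_mem_nhdsWithin.mono fun y hy => ?_)
  exact div_le_iff₀ hy

lemma exists_mem_slopeBoundedSide_iff {σ d : ℤˣ} :
    (∃ m : ℕ, x ∈ slopeBoundedSide σ d (m + 1) f) ↔
      (∃ w > 0, HasRoom d w x) ∧ upperSlope σ d f x ≠ ⊤ := by
  rw [upperSlope_ne_top_iff]
  constructor
  · rintro ⟨m, hroom, hslope⟩
    refine ⟨⟨_, by positivity, hroom⟩, m + 1, Metric.mem_nhdsWithin_iff.2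
      ⟨((m : ℝ) + 1)⁻¹, by positivity, fun y hy => ?_⟩⟩
    have hlt := hy.1
    rw [Metric.mem_ball, dist_comm, ← abs_ahead d] at hlt
    exact_mod_cast hslope y hy.2 ((le_abs_self _).trans_lt hlt)
  · rintro ⟨⟨w, hw, hroom⟩, m, hm⟩
    obtain ⟨ε, hε, hslope⟩ := Metric.mem_nhdsWithin_iff.1 hm
    have hlim : Tendsto (fun n : ℕ => ((n : ℝ) + 1)⁻¹) atTop (𝓝 0) := by
      simpa using tendsto_one_div_add_atTop_nhds_zero_nat (𝕜 := ℝ)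
    obtain ⟨n, ⟨hnw, hnε⟩, hmn⟩ := ((hlim.eventually_lt_const hw).and
      (hlim.eventually_lt_const hε)).and (eventually_ge_atTop m) |>.exists
    refine ⟨n, hroom.mono (by positivity) (by simpa using hnw.le), fun y hy0 hy1 => ?_⟩
    have hy : y ∈ Metric.ball x ε := by
      rw [Metric.mem_ball, dist_comm, ← abs_ahead d, abs_of_pos hy0]
      exact hy1.trans hnε
    have hmn' : (m : ℝ) ≤ n + 1 := by exact_mod_cast hmn.trans n.le_succ
    exact (hslope ⟨hy, hy0⟩).trans (by gcongr)

end Dini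

theorem nonKnot_eq_iUnion_slopeBounded (f : C(I, ℝ)) :
    nonKnot f = ⋃ m : ℕ, slopeBounded (m + 1) f := by
  ext x
  have hbounded : (∃ m : ℕ, x ∈ slopeBounded (m + 1) f) ↔
      ∃ d, (∃ w > 0, HasRoom d w x) ∧ ∃ σ, upperSlope σ d f x ≠ ⊤ := by
    simp only [mem_slopeBounded, exists_comm (α := ℕ), exists_mem_slopeBoundedSide_iff]
    rw [exists_comm]
    simp only [exists_and_left]
  rw [Set.mem_iUnion, hbounded, nonKnot, Set.mem_ofPred_eq, isKnotPoint_iff_upperSlope_eq_top]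
  push Not
  rfl

/-! ### The Banach–Mazur game -/

section BanachMazur

variable {X T : Type*} [TopologicalSpace X] {O : T → Set X}

/-- The sets `O s`, `s ∈ L`, are pairwise disjoint subsets of `G` with dense union in `G`. -/
structure IsDensePacking (O : T → Set X) (L : Set T) (G : Set X) : Prop where
  subset : ∀ s ∈ L, O s ⊆ G
  pairwiseDisjoint : L.PairwiseDisjoint O
  dense : G ⊆ closure (⋃ s ∈ L, O s)

lemma exists_isDensePacking {P : T → Prop} {G : Set X} (hG : IsOpen G)
    (hne : ∀ s, (O s).Nonempty)
    (H : ∀ W ⊆ G, IsOpen W → W.Nonempty → ∃ s, P s ∧ O s ⊆ W) :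
    ∃ L : Set T, (∀ s ∈ L, P s) ∧ IsDensePacking O L G := by
  obtain ⟨L, ⟨hLP, hLd⟩, hmax⟩ :=
    zorn_subset {L : Set T | (∀ s ∈ L, P s ∧ O s ⊆ G) ∧ L.PairwiseDisjoint O} (by
      refine fun C hC hchain => ⟨⋃₀ C, ⟨fun s ⟨l, hl, hs⟩ => (hC hl).1 s hs, ?_⟩,
        fun l hl => Set.subset_sUnion_of_mem hl⟩
      exact (Set.pairwiseDisjoint_sUnion hchain.directedOn).2 fun l hl => (hC hl).2)
  refine ⟨L, fun s hs => (hLP s hs).1, fun s hs => (hLP s hs).2, hLd, fun x hx => ?_⟩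
  by_contra hcl
  obtain ⟨s, hP, hsub⟩ := H (G ∩ (closure (⋃ s ∈ L, O s))ᶜ) Set.inter_subset_left
    (hG.inter isClosed_closure.isOpen_compl) ⟨x, hx, hcl⟩
  have hdisj : ∀ l ∈ L, Disjoint (O s) (O l) := fun l hl => Set.disjoint_left.2 fun y hy hyl =>
    (hsub hy).2 (subset_closure (Set.mem_biUnion hl hyl))
  have hmem : s ∈ L := by
    refine hmax (y := insert s L) ⟨?_, hLd.insert fun l hl _ => hdisj l hl⟩
      (Set.subset_insert _ _) (Set.mem_insert _ _)
    rintro l (rfl | hl)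
    · exact ⟨hP, hsub.trans Set.inter_subset_left⟩
    · exact hLP l hl
  exact (hne s).ne_empty (disjoint_self.1 (hdisj s hmem))

/-- The nodes at height `t` of the tree with root `s₀` and successor sets `succs`. -/
def treeLevel (succs : ℕ → T → Set T) (s₀ : T) : ℕ → Set T
  | 0 => {s₀}
  | t + 1 => ⋃ s ∈ treeLevel succs s₀ t, succs t s

section Tree

variable {succs : ℕ → T → Set T} {s₀ : T}

lemma mem_treeLevel_succ {t : ℕ} {s' : T} : s' ∈ treeLevel succs s₀ (t + 1) ↔
    ∃ s ∈ treeLevel succs s₀ t, s' ∈ succs t s := by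
  simp only [treeLevel, Set.mem_iUnion, exists_prop]

variable (hsuccs : ∀ t s, IsDensePacking O (succs t s) (O s))
include hsuccs

lemma pairwiseDisjoint_treeLevel (t : ℕ) : (treeLevel succs s₀ t).PairwiseDisjoint O := by
  induction t with
  | zero => exact Set.pairwiseDisjoint_singleton _ _
  | succ t ih =>
    exact Set.PairwiseDisjoint.biUnion (ih.mono fun s => iSup₂_le (hsuccs t s).subset)
      fun s _ => (hsuccs t s).pairwiseDisjoint

lemma dense_treeLevel (h₀ : O s₀ = Set.univ) (t : ℕ) :
    Dense (⋃ s ∈ treeLevel succs s₀ t, O s) := by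
  induction t with
  | zero => simp [treeLevel, h₀]
  | succ t ih =>
    refine dense_closure.1 (ih.mono (Set.iUnion₂_subset fun s hs => ?_))
    refine (hsuccs t s).dense.trans (closure_mono (Set.iUnion₂_subset fun s' hs' => ?_))
    exact Set.subset_biUnion_of_mem (u := O) (mem_treeLevel_succ.2 ⟨s, hs, hs'⟩)

end Tree

/-- Residually many points lie in all the sets `O s` along an infinite branch of a tree of
successively disjoint packings. -/
theorem residual_exists_chain {P : ℕ → T → T → Prop} {s₀ : T} (hO : ∀ s, IsOpen (O s))
    (hne : ∀ s, (O s).Nonempty) (h₀ : O s₀ = Set.univ)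
    (H : ∀ t s, ∀ W ⊆ O s, IsOpen W → W.Nonempty → ∃ s', P t s s' ∧ O s' ⊆ W) :
    {x | ∃ ch : ℕ → T, ch 0 = s₀ ∧ ∀ t, P t (ch t) (ch (t + 1)) ∧ x ∈ O (ch t)} ∈ residual X := by
  choose succs hsuccs hpack using fun t s => exists_isDensePacking (hO s) hne (H t s)
  have hres (t : ℕ) : ⋃ s ∈ treeLevel succs s₀ t, O s ∈ residual X :=
    residual_of_dense_open (isOpen_biUnion fun s _ => hO s) (dense_treeLevel hpack h₀ t)
  refine mem_of_superset (countable_iInter_mem.2 hres) fun x hx => ?_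
  simp only [Set.mem_iInter, Set.mem_iUnion₂, exists_prop] at hx
  choose ch hch hxch using hx
  refine ⟨ch, hch 0, fun t => ⟨?_, hxch t⟩⟩
  obtain ⟨s, hs, hsucc⟩ := mem_treeLevel_succ.1 (hch (t + 1))
  have hxs : x ∈ O s := (hpack t s).subset _ hsucc (hxch (t + 1))
  obtain rfl : s = ch t := (pairwiseDisjoint_treeLevel hpack t).elim hs (hch t)
    (Set.not_disjoint_iff.2 ⟨x, hxs, hxch t⟩)
  exact hsuccs t _ _ hsucc

end BanachMazur

section Transfer

variable {X Y T S : Type*} [TopologicalSpace X] [TopologicalSpace Y]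

lemma exists_isOpen_dense_iInter_subset [BaireSpace Y] {s : Set Y} (hs : s ∈ residual Y) :
    ∃ G : ℕ → Set Y, (∀ n, IsOpen (G n)) ∧ (∀ n, Dense (G n)) ∧ ⋂ n, G n ⊆ s := by
  obtain ⟨t, hts, htδ, htd⟩ := mem_residual.1 hs
  obtain ⟨G, hG, rfl⟩ := htδ.eq_iInter_nat
  exact ⟨G, hG, fun n => htd.mono (Set.iInter_subset _ _), hts⟩

lemma nonempty_iInter_closedBall {Z : Type*} [PseudoMetricSpace Z] [CompleteSpace Z] {y : ℕ → Z}
    {r : ℕ → ℝ} (hanti : Antitone fun t => Metric.closedBall (y t) (r t)) (hr0 : ∀ t, 0 ≤ r t)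
    (hr : Tendsto r atTop (𝓝 0)) : (⋂ t, Metric.closedBall (y t) (r t)).Nonempty := by
  refine Metric.nonempty_iInter_of_nonempty_biInter (fun _ => Metric.isClosed_closedBall)
    (fun _ => Metric.isBounded_closedBall) (fun t => ⟨y t, ?_⟩) ?_
  · exact Set.mem_iInter₂.2 fun n hn => hanti hn (Metric.mem_closedBall_self (hr0 t))
  · exact squeeze_zero (fun _ => Metric.diam_nonneg)
      (fun t => Metric.diam_closedBall (hr0 t)) (by simpa using hr.const_mul 2)

/-- Suppose that positions `b : T` and `c : S` of an alternating game carry open sets of `X` and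
of `Y`, that a move from `b` to `c` may enter any open subset of `U b`, and that a move from `c` to
`b` may enter any open subset of `V' c`. Then the limits of plays transfer residuality from `Y` to
`X`: play the game in `X` while steering in `Y` towards a point of the given residual set. -/
theorem residual_exists_play [IsCompletelyMetrizableSpace Y]
    {U : T → Set X} {V : T → Set Y} {U' : S → Set X} {V' : S → Set Y}
    (hU : ∀ b, IsOpen (U b)) (hUne : ∀ b, (U b).Nonempty)
    (hV' : ∀ c, IsOpen (V' c)) (hV'ne : ∀ c, (V' c).Nonempty)
    {P : T → S → Prop} {Q : S → T → Prop}
    (hP : ∀ b c, P b c → V' c ⊆ V b) (hQ : ∀ c b, Q c b → U b ⊆ U' c)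
    (hX : ∀ b, ∀ W ⊆ U b, IsOpen W → W.Nonempty → ∃ c, P b c ∧ U' c ⊆ W)
    (hY : ∀ c, ∀ W ⊆ V' c, IsOpen W → W.Nonempty → ∃ b, Q c b ∧ V b ⊆ W)
    {b₀ : T} (h₀ : U b₀ = Set.univ) {s : Set Y} (hs : s ∈ residual Y) :
    {x | ∃ y ∈ s, ∃ (b : ℕ → T) (c : ℕ → S), b 0 = b₀ ∧
      ∀ t, P (b t) (c t) ∧ Q (c t) (b (t + 1)) ∧ x ∈ U (b t) ∧ y ∈ V (b t)} ∈ residual X := by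
  let := upgradeIsCompletelyMetrizable Y
  obtain ⟨G, hGo, hGd, hGs⟩ := exists_isOpen_dense_iInter_subset hs
  let move (t : ℕ) (b b' : T) : Prop := ∃ c, P b c ∧ Q c b' ∧ ∃ y r, 0 ≤ r ∧ r ≤ 1 / ((t : ℝ) + 1) ∧
    V b' ⊆ Metric.closedBall y r ∧ Metric.closedBall y r ⊆ V' c ∩ G t
  have hmove (t b) (W) (hWU : W ⊆ U b) (hW : IsOpen W) (hWne : W.Nonempty) :
      ∃ b', move t b b' ∧ U b' ⊆ W := by
    obtain ⟨c, hbc, hcW⟩ := hX b W hWU hW hWne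
    obtain ⟨y, hy⟩ := (hGd t).inter_open_nonempty _ (hV' c) (hV'ne c)
    obtain ⟨r, hr, hball⟩ := Metric.nhds_basis_closedBall.mem_iff.1
      (((hV' c).inter (hGo t)).mem_nhds hy)
    obtain ⟨r', hr', hle⟩ : ∃ r' > 0, r' ≤ min r (1 / ((t : ℝ) + 1)) :=
      ⟨_, lt_min hr (by positivity), le_rfl⟩
    have hball' : Metric.closedBall y r' ⊆ V' c ∩ G t :=
      (Metric.closedBall_subset_closedBall (hle.trans (min_le_left _ _))).trans hball
    obtain ⟨b', hcb', hb'⟩ := hY c (Metric.ball y r')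
      (Metric.ball_subset_closedBall.trans (hball'.trans Set.inter_subset_left))
      Metric.isOpen_ball ⟨y, Metric.mem_ball_self hr'⟩
    exact ⟨b', ⟨c, hbc, hcb', y, r', hr'.le, hle.trans (min_le_right _ _),
      hb'.trans Metric.ball_subset_closedBall, hball'⟩, (hQ c b' hcb').trans hcW⟩
  refine mem_of_superset (residual_exists_chain hU hUne h₀ hmove) ?_
  rintro x ⟨b, hb0, hb⟩
  choose c hPc hQc y r hr0 hr hVy hyV using fun t => (hb t).1
  have hnested (t : ℕ) :
      Metric.closedBall (y (t + 1)) (r (t + 1)) ⊆ Metric.closedBall (y t) (r t) :=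
    (hyV (t + 1)).trans (Set.inter_subset_left.trans ((hP _ _ (hPc (t + 1))).trans (hVy t)))
  obtain ⟨z, hz⟩ := nonempty_iInter_closedBall (antitone_nat_of_succ_le hnested) hr0
    (squeeze_zero hr0 hr tendsto_one_div_add_atTop_nhds_zero_nat)
  rw [Set.mem_iInter] at hz
  exact ⟨z, hGs (Set.mem_iInter.2 fun t => (hyV t (hz t)).2), b, c, hb0, fun t =>
    ⟨hPc t, hQc t, (hb t).2, hP _ _ (hPc t) (hyV t (hz t)).1⟩⟩

end Transfer

/-! ### Sequences of closed sets -/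

lemma exists_eball_pi_subset {ι E : Type*} [PseudoEMetricSpace E] {W : Set (ι → E)}
    (hW : IsOpen W) {K : ι → E} (hK : K ∈ W) :
    ∃ J : Finset ι, ∃ ε > (0 : ℝ), {K' | ∀ j ∈ J, edist (K' j) (K j) < ENNReal.ofReal ε} ⊆ W := by
  obtain ⟨J, u, hu, hJ⟩ := isOpen_pi_iff.1 hW K hK
  have hsmall : ∀ᶠ ε in 𝓝[>] (0 : ℝ),
      ∀ j ∈ J, Metric.eball (K j) (ENNReal.ofReal ε) ⊆ u j := by
    rw [Filter.eventually_all_finset]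
    intro j hj
    obtain ⟨r, hr, hsub⟩ := EMetric.isOpen_iff.1 (hu j hj).1 _ (hu j hj).2
    have hlim : Tendsto ENNReal.ofReal (𝓝[>] 0) (𝓝 0) := by
      simpa using (ENNReal.continuous_ofReal.tendsto 0).mono_left nhdsWithin_le_nhds
    filter_upwards [hlim.eventually_lt_const hr] with ε hε
    exact (Metric.eball_subset_eball hε.le).trans hsub
  obtain ⟨ε, hε, hpos⟩ := (hsmall.and self_mem_nhdsWithin).exists
  exact ⟨J, ε, hpos, fun K' hK' => hJ fun j hj => hε j hj (hK' j hj)⟩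

section Cylinder

variable {α : Type*} [MetricSpace α] {N N' : ℕ} {F F' : ℕ → Finset α} {ρ ρ' ε : ℝ}
  {K : ℕ → Closeds α} {i : ℕ} {x p : α}

/-- A finite set, as a closed set. -/
def ofFinset (F : Finset α) : Closeds α := ⟨F, F.finite_toSet.isClosed⟩

/-- The sequences of closed sets whose first `N` terms are `ρ`-close to the finite sets `F i`. -/
def cylinder (N : ℕ) (F : ℕ → Finset α) (ρ : ℝ) : Set (ℕ → Closeds α) :=
  {K | ∀ i < N, edist (K i) (ofFinset (F i)) < ENNReal.ofReal ρ}

lemma isOpen_cylinder (N : ℕ) (F : ℕ → Finset α) (ρ : ℝ) : IsOpen (cylinder N F ρ) := by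
  have hpi : cylinder N F ρ =
      (Set.Iio N).pi fun i => Metric.eball (ofFinset (F i)) (ENNReal.ofReal ρ) := rfl
  rw [hpi]
  exact isOpen_set_pi (Set.finite_Iio N) fun _ _ => Metric.isOpen_eball

lemma ofFinset_mem_cylinder (N : ℕ) (F : ℕ → Finset α) (hρ : 0 < ρ) :
    (fun i => ofFinset (F i)) ∈ cylinder N F ρ := fun i _ => by simpa using hρ

lemma exists_dist_lt_of_mem_cylinder (hK : K ∈ cylinder N F ρ) (hi : i < N) (hx : x ∈ K i) :
    ∃ p ∈ F i, dist x p < ρ := by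
  obtain ⟨p, hp, hxp⟩ := Metric.exists_edist_lt_of_hausdorffEDist_lt hx (hK i hi)
  rw [edist_lt_ofReal] at hxp
  exact ⟨p, hp, hxp⟩

lemma exists_mem_dist_lt_of_mem_cylinder (hK : K ∈ cylinder N F ρ) (hi : i < N) (hp : p ∈ F i) :
    ∃ x ∈ K i, dist x p < ρ := by
  have hlt := hK i hi
  rw [edist_comm] at hlt
  obtain ⟨x, hx, hpx⟩ := Metric.exists_edist_lt_of_hausdorffEDist_lt (x := p) hp hlt
  rw [edist_lt_ofReal, dist_comm] at hpx
  exact ⟨x, hx, hpx⟩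

lemma edist_ofFinset_le {K : Closeds α} {F : Finset α}
    (hK : ∀ x ∈ K, ∃ p ∈ F, dist x p ≤ ε) (hF : ∀ p ∈ F, ∃ x ∈ K, dist x p ≤ ε) :
    edist K (ofFinset F) ≤ ENNReal.ofReal ε := by
  refine Metric.hausdorffEDist_le_of_mem_edist (fun x hx => ?_) (fun p hp => ?_)
  · obtain ⟨p, hp, hxp⟩ := hK x hx
    exact ⟨p, hp, by rw [edist_dist]; exact ENNReal.ofReal_le_ofReal hxp⟩
  · obtain ⟨x, hx, hxp⟩ := hF p hp
    exact ⟨x, hx, by rw [edist_comm, edist_dist]; exact ENNReal.ofReal_le_ofReal hxp⟩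

lemma cylinder_subset_cylinder (hN : N ≤ N') (hε : 0 ≤ ε) (hρ' : 0 ≤ ρ')
    (hF : ∀ i < N, edist (ofFinset (F' i)) (ofFinset (F i)) ≤ ENNReal.ofReal ε)
    (hρ : ρ' + ε ≤ ρ) : cylinder N' F' ρ' ⊆ cylinder N F ρ := by
  intro K hK i hi
  calc edist (K i) (ofFinset (F i))
      ≤ edist (K i) (ofFinset (F' i)) + edist (ofFinset (F' i)) (ofFinset (F i)) :=
        edist_triangle _ _ _
    _ < ENNReal.ofReal ρ' + ENNReal.ofReal ε :=
        ENNReal.add_lt_add_of_lt_of_le (ne_top_of_le_ne_top ENNReal.ofReal_ne_top (hF i hi))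
          (hK i (hi.trans_le hN)) (hF i hi)
    _ ≤ ENNReal.ofReal ρ := by
        rw [← ENNReal.ofReal_add hρ' hε]; exact ENNReal.ofReal_le_ofReal hρ

variable [CompactSpace α] [∀ x : α, (𝓝[≠] x).NeBot]

lemma exists_finset_near (K : Closeds α) (B : Finset α) (hε : 0 < ε) :
    ∃ F : Finset α, Disjoint F B ∧ edist K (ofFinset F) ≤ ENNReal.ofReal ε := by
  classical
  obtain ⟨s, hsK, hsf, hcov⟩ := K.isClosed.isCompact.finite_cover_balls (half_pos hε)
  have havoid (x : α) : ∃ y ∉ B, dist x y < ε / 2 := by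
    obtain ⟨y, hy, hxy⟩ := (dense_univ.sdiff_finset B).exists_dist_lt x (half_pos hε)
    exact ⟨y, hy.2, hxy⟩
  choose φ hφB hφ using havoid
  refine ⟨hsf.toFinset.image φ, ?_, edist_ofFinset_le (fun x hx => ?_) fun y hy => ?_⟩
  · rw [Finset.disjoint_left, Finset.forall_mem_image]
    exact fun x _ => hφB x
  · obtain ⟨z, hz, hxz⟩ := Set.mem_iUnion₂.1 (hcov hx)
    refine ⟨φ z, Finset.mem_image_of_mem _ (hsf.mem_toFinset.2 hz), ?_⟩
    linarith [dist_triangle x z (φ z), hφ z, Metric.mem_ball.1 hxz]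
  · obtain ⟨x, hx, rfl⟩ := Finset.mem_image.1 hy
    exact ⟨x, hsK (hsf.mem_toFinset.1 hx), by linarith [hφ x]⟩

lemma exists_disjoint_finsets_near (K : ℕ → Closeds α) (hε : 0 < ε) (N : ℕ) :
    ∃ F : ℕ → Finset α, (Set.Iio N).PairwiseDisjoint F ∧
      ∀ i < N, edist (K i) (ofFinset (F i)) ≤ ENNReal.ofReal ε := by
  classical
  induction N with
  | zero => exact ⟨fun _ => ∅, by simp, by simp⟩
  | succ N ih =>
    obtain ⟨F, hF, hFK⟩ := ih
    obtain ⟨G, hG, hGK⟩ := exists_finset_near (K N) ((Finset.range N).biUnion F) hε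
    have hupdate {i} (hi : i < N) : Function.update F N G i = F i :=
      Function.update_of_ne hi.ne _ _
    refine ⟨Function.update F N G, ?_, fun i hi => ?_⟩
    · rw [← Order.succ_eq_add_one, Order.Iio_succ_eq_insert]
      refine Set.PairwiseDisjoint.insert (fun i hi j hj hij => ?_) fun i hi _ => ?_
      · simpa only [Function.onFun, hupdate hi, hupdate hj] using hF hi hj hij
      · rw [Function.update_self, hupdate hi]
        exact (Finset.disjoint_biUnion_right _ _ _).1 hG i (Finset.mem_range.2 hi)
    · rcases Nat.lt_succ_iff_lt_or_eq.1 hi with hi | rfl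
      · rw [hupdate hi]
        exact hFK i hi
      · rwa [Function.update_self]

theorem exists_cylinder_subset {W : Set (ℕ → Closeds α)} (hW : IsOpen W) (hne : W.Nonempty)
    (N₀ : ℕ) : ∃ N ≥ N₀, ∃ F : ℕ → Finset α, (Set.Iio N).PairwiseDisjoint F ∧
      ∃ δ₀ > 0, ∀ δ ≤ δ₀, cylinder N F δ ⊆ W := by
  obtain ⟨K, hK⟩ := hne
  obtain ⟨J, ε, hε, hJ⟩ := exists_eball_pi_subset hW hK
  obtain ⟨N₁, hN₁⟩ := J.exists_nat_subset_range
  obtain ⟨F, hF, hFK⟩ := exists_disjoint_finsets_near K (half_pos hε) (max N₀ N₁)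
  refine ⟨max N₀ N₁, le_max_left _ _, F, hF, ε / 2, half_pos hε, fun δ hδ K' hK' => hJ ?_⟩
  intro j hj
  have hjN : j < max N₀ N₁ := (Finset.mem_range.1 (hN₁ hj)).trans_le (le_max_right _ _)
  calc edist (K' j) (K j)
      ≤ edist (K' j) (ofFinset (F j)) + edist (K j) (ofFinset (F j)) := edist_triangle_right _ _ _
    _ < ENNReal.ofReal (ε / 2) + ENNReal.ofReal (ε / 2) :=
        ENNReal.add_lt_add_of_lt_of_le (ne_top_of_le_ne_top ENNReal.ofReal_ne_top (hFK j hjN))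
          ((hK' j hjN).trans_le (ENNReal.ofReal_le_ofReal hδ)) (hFK j hjN)
    _ = ENNReal.ofReal ε := by
        rw [← ENNReal.ofReal_add (by positivity) (by positivity), add_halves]

end Cylinder

/-! ### Functions with spikes at the points of a grid -/

section Grid

/-- The distance between neighbouring points of the grid `0, 1/R, …, 1`. -/
noncomputable def mesh (R : ℕ) : ℝ := (R : ℝ)⁻¹

/-- The point `k/R` of the grid `0, 1/R, …, 1`. -/
noncomputable def gridPoint {R : ℕ} (k : Fin (R + 1)) : I :=
  ⟨k / R, by positivity,
    div_le_one_of_le₀ (by exact_mod_cast Nat.lt_succ_iff.1 k.2) (Nat.cast_nonneg R)⟩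

/-- The sign `(-1) ^ k` attached to the `k`-th point of a grid. -/
def sgn {R : ℕ} (k : Fin (R + 1)) : ℤˣ := (-1) ^ (k : ℕ)

variable {R : ℕ} {k l : Fin (R + 1)} {x : I}

lemma mesh_pos (hR : 0 < R) : 0 < mesh R := inv_pos.2 (Nat.cast_pos.2 hR)

lemma mesh_le_one : mesh R ≤ 1 := Nat.cast_inv_le_one R

lemma mesh_le_dist_gridPoint (hkl : k ≠ l) : mesh R ≤ dist (gridPoint k) (gridPoint l) := by
  have hone : (1 : ℤ) ≤ |(k : ℤ) - l| := Int.one_le_abs (by omega)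
  calc mesh R = 1 / R := (one_div _).symm
    _ ≤ |(k : ℝ) - l| / R := by gcongr; exact_mod_cast hone
    _ = dist (gridPoint k) (gridPoint l) := by
      rw [Subtype.dist_eq, Real.dist_eq, gridPoint, gridPoint, ← sub_div, abs_div, Nat.abs_cast]

lemma eq_of_dist_gridPoint_lt {s t : ℝ} (hk : dist x (gridPoint k) ≤ s)
    (hl : dist x (gridPoint l) ≤ t) (hst : s + t < mesh R) : k = l := by
  by_contra hne
  linarith [mesh_le_dist_gridPoint hne, dist_triangle_left (gridPoint k) (gridPoint l) x]

lemma exists_nat_abs_sub_le_one (σ : ℤˣ) {a : ℝ} (ha : 0 ≤ a) :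
    ∃ l : ℕ, (-1 : ℤˣ) ^ l = σ ∧ |(l : ℝ) - a| ≤ 1 := by
  have hle := Nat.floor_le ha
  have hlt := Nat.lt_floor_add_one a
  by_cases h : (-1 : ℤˣ) ^ ⌊a⌋₊ = σ
  · exact ⟨⌊a⌋₊, h, abs_le.2 ⟨by linarith, by linarith⟩⟩
  · refine ⟨⌊a⌋₊ + 1, ?_, abs_le.2 ⟨by push_cast; linarith, by push_cast; linarith⟩⟩
    rw [pow_succ, Int.units_ne_iff_eq_neg.1 h]
    simp

lemma exists_gridPoint_ahead (hR : 0 < R) (σ : ℤˣ) {d : ℤˣ} (hroom : HasRoom d (3 * mesh R) x) :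
    ∃ k : Fin (R + 1), sgn k = σ ∧ mesh R / 2 ≤ ahead d x (gridPoint k) ∧
      ahead d x (gridPoint k) ≤ 5 / 2 * mesh R := by
  have hR' : (0 : ℝ) < R := Nat.cast_pos.2 hR
  have hx := x.2
  set a : ℝ := x * R + d * (3 / 2) with ha
  have hmesh : mesh R * R = 1 := inv_mul_cancel₀ hR'.ne'
  have hbounds : 0 ≤ a ∧ a + 1 ≤ R := by
    have hlo := mul_nonneg hroom.1 hR'.le
    have hhi := mul_le_mul_of_nonneg_right hroom.2 hR'.le
    have hx0 := mul_nonneg hx.1 hR'.le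
    have hx1 := mul_le_mul_of_nonneg_right hx.2 hR'.le
    rw [add_mul, mul_assoc, mul_assoc, hmesh] at hlo hhi
    rcases Int.units_eq_one_or d with rfl | rfl <;>
      simp only [Units.val_one, Units.val_neg, Int.cast_one, Int.cast_neg] at ha hlo hhi <;>
      constructor <;> linarith
  obtain ⟨l, hlσ, hla⟩ := exists_nat_abs_sub_le_one σ hbounds.1
  have hlR : l ≤ R := by
    have : (l : ℝ) ≤ R := by linarith [(abs_le.1 hla).2]
    exact_mod_cast this
  have hahead : ahead d x (gridPoint (⟨l, Nat.lt_succ_of_le hlR⟩ : Fin (R + 1))) =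
      (d * (l - a) + 3 / 2) * mesh R := by
    simp only [ahead, gridPoint, mesh, ha]
    field_simp
    linear_combination (3 : ℝ) * coe_units_mul_self d
  rw [← abs_units_mul d] at hla
  refine ⟨⟨l, Nat.lt_succ_of_le hlR⟩, hlσ, ?_, ?_⟩ <;> rw [hahead] <;>
    nlinarith [abs_le.1 hla, mesh_pos hR]

end Grid

/-- Data for a family of continuous functions: they stay within `ω` of `g` off the balls of radius
`r` around the points of the grid `0, 1/R, …, 1`, and in the ball around `k/R` they have a spike
of height about `A` and sign `(-1) ^ k`. -/
structure SpikeGrid where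
  g : C(I, ℝ)
  R : ℕ
  A : ℝ
  ω : ℝ
  r : ℝ
  R_pos : 0 < R
  A_pos : 0 < A
  ω_pos : 0 < ω
  r_pos : 0 < r
  ω_le : ω ≤ A / 16
  r_le : r ≤ mesh R / 32
  osc_le : ∀ x y, dist x y ≤ 3 * mesh R → |g x - g y| ≤ A / 8

namespace SpikeGrid

variable (D : SpikeGrid)

/-- The `k`-th point of the grid of `D`. -/
noncomputable abbrev pt (k : Fin (D.R + 1)) : I := gridPoint k

/-- `f` belongs to the family of functions described by `D`. -/
structure IsSpiked (f : C(I, ℝ)) : Prop where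
  near : ∀ x, (∀ k, D.r ≤ dist x (D.pt k)) → |f x - D.g x| ≤ D.ω
  lower : ∀ k x, dist x (D.pt k) ≤ D.r → sgn k * D.g x - D.ω ≤ sgn k * f x
  upper : ∀ k x, dist x (D.pt k) ≤ D.r → sgn k * f x ≤ sgn k * D.g (D.pt k) + D.A + D.ω
  exists_peak : ∀ k, ∃ x, dist x (D.pt k) ≤ D.r ∧
    sgn k * D.g (D.pt k) + D.A - D.ω ≤ sgn k * f x

/-- The grid is so fine, compared with the height of the spikes, that every window of length `c⁻¹`
contains a spike of either sign, too steep for the slope `c`. -/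
def Resolves (c : ℝ) : Prop := 3 * c * mesh D.R < 1 ∧ 24 * c * mesh D.R ≤ D.A

variable {D} {f f₀ f' : C(I, ℝ)} {σ d : ℤˣ} {c c' κ δ : ℝ} {k l : Fin (D.R + 1)} {x y : I}

lemma mesh_pos : 0 < mesh D.R := KnotPoints.mesh_pos D.R_pos

lemma Resolves.mono (h : D.Resolves c') (hle : c ≤ c') : D.Resolves c := by
  have := mul_le_mul_of_nonneg_right hle D.mesh_pos.le
  exact ⟨by linarith [h.1], by linarith [h.2]⟩

lemma eq_of_dist_le (hk : dist x (D.pt k) ≤ mesh D.R / 2) (hl : dist x (D.pt l) ≤ D.r) : k = l :=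
  eq_of_dist_gridPoint_lt hk hl (by linarith [D.r_le, D.mesh_pos])

lemma abs_sign_mul_sub_le (σ : ℤˣ) (h : dist x y ≤ 3 * mesh D.R) :
    |σ * D.g x - σ * D.g y| ≤ D.A / 8 := by
  rw [abs_units_mul_sub_mul]; exact D.osc_le x y h

lemma abs_sign_mul_sub_pt_le (σ : ℤˣ) (h : dist x (D.pt k) ≤ mesh D.R / 2) :
    |σ * D.g x - σ * D.g (D.pt k)| ≤ D.A / 8 :=
  abs_sign_mul_sub_le σ (by linarith [D.mesh_pos])

lemma dist_le_half_mesh (h : dist x (D.pt k) ≤ D.r) : dist x (D.pt k) ≤ mesh D.R / 2 := by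
  linarith [D.r_le, D.mesh_pos]

namespace IsSpiked

variable (hf : D.IsSpiked f)

include hf

/-- The next spike of sign `σ` is too steep for the slope `c` unless `σ f x` exceeds `σ g x`. -/
theorem notMem_slopeBoundedSide (hc : 0 < c) (hD : D.Resolves c)
    (hx : σ * f x ≤ σ * D.g x + D.ω) : x ∉ slopeBoundedSide σ d c f := by
  rintro ⟨hroom, hslope⟩
  have hmesh := D.mesh_pos
  have hwindow : 3 * mesh D.R < c⁻¹ := by
    rw [lt_inv_comm₀ (by positivity) hc, ← one_div, lt_div_iff₀ (by positivity)]
    linarith [hD.1]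
  obtain ⟨k, rfl, hge, hle⟩ := exists_gridPoint_ahead (x := x) D.R_pos σ
    (hroom.mono (by positivity) (by simpa using hwindow.le))
  obtain ⟨y, hyk, hpeak⟩ := hf.exists_peak k
  have hr := D.r_le
  have hyk' := abs_le.1 ((abs_ahead d (D.pt k) y).trans_le ((dist_comm _ _).trans_le hyk))
  have hadd := ahead_add d x (D.pt k) y
  have hy0 : 0 < ahead d x y := by linarith
  have hy3 : ahead d x y ≤ 3 * mesh D.R := by linarith
  have hxk : dist x (D.pt k) ≤ 3 * mesh D.R := by
    rw [← abs_ahead d, abs_of_nonneg (by linarith)]; linarith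
  have hg := abs_le.1 (abs_sign_mul_sub_le (sgn k) hxk)
  have hrise := hslope y hy0 (hy3.trans_lt hwindow)
  have hcap : c * ahead d x y ≤ D.A / 8 := by
    linarith [mul_le_mul_of_nonneg_left hy3 hc.le, hD.2]
  linarith [D.ω_le, D.A_pos]

lemma notMem_slopeBounded (hc : 0 < c) (hD : D.Resolves c) (hx : |f x - D.g x| ≤ D.ω) :
    x ∉ slopeBounded c f := by
  intro h
  obtain ⟨σ, d, h⟩ := mem_slopeBounded.1 h
  refine hf.notMem_slopeBoundedSide hc hD ?_ h
  rw [← abs_units_mul_sub_mul σ] at hx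
  linarith [(abs_le.1 hx).2]

lemma exists_dist_pt_lt (hc : 0 < c) (hD : D.Resolves c) (hx : x ∈ slopeBounded c f) :
    ∃ k, dist x (D.pt k) < D.r := by
  by_contra! h
  exact hf.notMem_slopeBounded hc hD (hf.near x h) hx

lemma eq_sgn_of_mem_slopeBoundedSide (hc : 0 < c) (hD : D.Resolves c)
    (hxk : dist x (D.pt k) ≤ D.r) (hx : x ∈ slopeBoundedSide σ d c f) : σ = sgn k := by
  by_contra hne
  refine hf.notMem_slopeBoundedSide hc hD ?_ hx
  have := hf.lower k x hxk
  rw [Int.units_ne_iff_eq_neg.1 hne]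
  push_cast
  linarith

lemma abs_sub_le_of_dist_eq_r (hx : dist x (D.pt k) = D.r) : |f x - D.g x| ≤ D.ω := by
  refine hf.near x fun l => ?_
  by_contra! hlt
  obtain rfl := eq_of_dist_le (dist_le_half_mesh hx.le) hlt.le
  exact hlt.ne hx

/-- Between the ball of radius `r` and half the mesh, the function stays well below the peak. -/
lemma le_of_dist_le (hy : D.r < dist y (D.pt k)) (hy' : dist y (D.pt k) ≤ mesh D.R / 2) :
    sgn k * f y ≤ sgn k * D.g (D.pt k) + D.A / 8 + D.ω := by
  have hoff (l) : D.r ≤ dist y (D.pt l) := by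
    by_contra! hlt
    obtain rfl := eq_of_dist_le hy' hlt.le
    linarith
  have hnear := abs_le.1 ((abs_units_mul_sub_mul (sgn k) _ _).trans_le (hf.near y hoff))
  linarith [abs_le.1 (abs_sign_mul_sub_pt_le (sgn k) hy')]

/-- A spike of `f` is dominated by a spike of `f₀` of the same sign, and by `f₀` on the boundary of
the ball if the sign is the opposite one. -/
theorem exists_near_le (hf₀ : D.IsSpiked f₀) (hκ : 0 ≤ κ)
    (hosc : ∀ x y, dist x y ≤ 2 * D.r → |D.g x - D.g y| ≤ κ) (σ : ℤˣ) (y : I) :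
    ∃ z, dist z y ≤ 2 * D.r ∧ σ * f y ≤ σ * f₀ z + 2 * D.ω + κ := by
  by_cases hoff : ∀ l, D.r ≤ dist y (D.pt l)
  · refine ⟨y, by simp [D.r_pos.le], ?_⟩
    linarith [abs_le.1 ((abs_units_mul_sub_mul σ _ _).trans_le (hf.near y hoff)),
      abs_le.1 ((abs_units_mul_sub_mul σ _ _).trans_le (hf₀.near y hoff))]
  push Not at hoff
  obtain ⟨l, hyl⟩ := hoff
  have hball {z} (hz : dist z (D.pt l) ≤ D.r) : dist z y ≤ 2 * D.r := by
    linarith [dist_triangle_right z y (D.pt l)]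
  rcases eq_or_ne σ (sgn l) with rfl | hne
  · obtain ⟨z, hz, hpeak⟩ := hf₀.exists_peak l
    exact ⟨z, hball hz, by linarith [hf.upper l y hyl.le]⟩
  · obtain ⟨z, hz⟩ : ∃ z, dist z (D.pt l) = D.r := by
      obtain ⟨d, hd⟩ := exists_hasRoom D.r_pos.le
        (by linarith [D.r_le, mesh_le_one (R := D.R)]) (D.pt l)
      obtain ⟨z, hz⟩ := hd.exists_ahead_eq
      exact ⟨z, by rw [dist_comm, ← abs_ahead d, hz, abs_of_pos D.r_pos]⟩
    refine ⟨z, hball hz.le, ?_⟩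
    have hz₀ := (abs_units_mul_sub_mul (sgn l) _ _).trans_le (hf₀.abs_sub_le_of_dist_eq_r hz)
    have hgz := (abs_units_mul_sub_mul (sgn l) _ _).trans_le (hosc z y (hball hz.le))
    rw [Int.units_ne_iff_eq_neg.1 hne]
    push_cast
    linarith [hf.lower l y hyl.le, abs_le.1 hz₀, abs_le.1 hgz]

lemma dist_le : dist f D.g ≤ 2 * D.A := by
  have hω := D.ω_le
  have hA := D.A_pos
  refine (ContinuousMap.dist_le (by linarith)).2 fun x => ?_
  rw [Real.dist_eq]
  by_cases hoff : ∀ l, D.r ≤ dist x (D.pt l)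
  · exact (hf.near x hoff).trans (by linarith)
  push Not at hoff
  obtain ⟨l, hxl⟩ := hoff
  have hg := abs_le.1 (abs_sign_mul_sub_pt_le (sgn l) (dist_le_half_mesh hxl.le))
  rw [← abs_units_mul_sub_mul (sgn l), abs_le]
  constructor <;> linarith [hf.lower l x hxl.le, hf.upper l x hxl.le]

end IsSpiked

section Spikes

variable (D) (G : Fin (D.R + 1) → Finset I) (hδ : 0 < δ)

/-- The function equal to `g` at distance at least `δ` from the sets `G k`, whose spike of sign
`(-1) ^ k` reaches the height `A` exactly at the points of `G k`. -/
noncomputable def spikes : C(I, ℝ) where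
  toFun x := D.g x + ∑ k, thickenedIndicator hδ (G k : Set I) x *
    (D.g (D.pt k) + sgn k * D.A - D.g x)

variable {D G}

lemma thickenedIndicator_eq_zero {s : Finset I} (h : ∀ p ∈ s, δ ≤ dist x p) :
    thickenedIndicator hδ (s : Set I) x = 0 :=
  thickenedIndicator_zero hδ _ fun hx => by
    obtain ⟨p, hp, hlt⟩ := Metric.mem_thickening_iff.1 hx
    exact (h p hp).not_gt hlt

lemma spikes_of_le_dist (hx : ∀ k, ∀ p ∈ G k, δ ≤ dist x p) : D.spikes G hδ x = D.g x := by
  refine add_eq_left.2 (Finset.sum_eq_zero fun k _ => ?_)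
  rw [thickenedIndicator_eq_zero hδ (hx k), NNReal.coe_zero, zero_mul]

variable (hG : ∀ k, ∀ p ∈ G k, dist p (D.pt k) + δ ≤ D.r)

include hG

lemma sgn_mul_spikes (hx : dist x (D.pt k) ≤ D.r) :
    sgn k * D.spikes G hδ x = sgn k * D.g x + thickenedIndicator hδ (G k : Set I) x *
      (sgn k * D.g (D.pt k) + D.A - sgn k * D.g x) := by
  have hother (l) (hlk : l ≠ k) : thickenedIndicator hδ (G l : Set I) x = 0 :=
    thickenedIndicator_eq_zero hδ fun p hp => by
      by_contra! hlt
      refine hlk (eq_of_dist_le (dist_le_half_mesh ?_) hx)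
      linarith [hG l p hp, dist_triangle x p (D.pt l)]
  have hsum : D.spikes G hδ x = D.g x + thickenedIndicator hδ (G k : Set I) x *
      (D.g (D.pt k) + sgn k * D.A - D.g x) := by
    simp only [spikes, ContinuousMap.coe_mk, add_right_inj]
    exact Finset.sum_eq_single k (fun l _ hlk => by simp [hother l hlk]) (by simp)
  rw [hsum]
  linear_combination (thickenedIndicator hδ (G k : Set I) x * D.A : ℝ) *
    coe_units_mul_self (sgn k)

lemma sgn_mul_spikes_of_mem {p : I} (hp : p ∈ G k) :
    sgn k * D.spikes G hδ p = sgn k * D.g (D.pt k) + D.A := by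
  rw [sgn_mul_spikes hδ hG (by linarith [hG k p hp]), thickenedIndicator_one hδ _ hp]
  push_cast
  ring

lemma sgn_mul_spikes_mem_Icc (hx : dist x (D.pt k) ≤ D.r) :
    sgn k * D.spikes G hδ x ∈ Set.Icc (sgn k * D.g x : ℝ) (sgn k * D.g (D.pt k) + D.A) := by
  have hheight : 0 ≤ sgn k * D.g (D.pt k) + D.A - sgn k * D.g x := by
    linarith [abs_le.1 (abs_sign_mul_sub_pt_le (sgn k) (dist_le_half_mesh hx)), D.A_pos]
  have hle : (thickenedIndicator hδ (G k : Set I) x : ℝ) ≤ 1 :=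
    mod_cast thickenedIndicator_le_one hδ _ x
  rw [sgn_mul_spikes hδ hG hx]
  constructor
  · linarith [mul_nonneg (thickenedIndicator hδ (G k : Set I) x).coe_nonneg hheight]
  · linarith [mul_le_mul_of_nonneg_right hle hheight]

theorem isSpiked_of_near_spikes (hne : ∀ k, (G k).Nonempty)
    (hf : ∀ x, |f x - D.spikes G hδ x| ≤ D.ω) : D.IsSpiked f := by
  have hclose (σ : ℤˣ) (x) := abs_le.1 ((abs_units_mul_sub_mul σ _ _).trans_le (hf x))
  refine ⟨fun x hx => ?_, fun k x hx => ?_, fun k x hx => ?_, fun k => ?_⟩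
  · rw [← spikes_of_le_dist hδ fun k p hp => ?_]
    · exact hf x
    · linarith [hx k, hG k p hp, dist_triangle x p (D.pt k)]
  · linarith [(hclose (sgn k) x).1, (sgn_mul_spikes_mem_Icc hδ hG hx).1]
  · linarith [(hclose (sgn k) x).2, (sgn_mul_spikes_mem_Icc hδ hG hx).2]
  · obtain ⟨p, hp⟩ := hne k
    exact ⟨p, by linarith [hG k p hp],
      by linarith [(hclose (sgn k) p).1, sgn_mul_spikes_of_mem hδ hG hp]⟩

end Spikes

lemma exists_isSpiked (D : SpikeGrid) : ∃ f, D.IsSpiked f := by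
  have hG (k : Fin (D.R + 1)) (p) (hp : p ∈ ({D.pt k} : Finset I)) :
      dist p (D.pt k) + D.r ≤ D.r := by
    rw [Finset.mem_singleton.1 hp, dist_self, zero_add]
  exact ⟨D.spikes (fun k => {D.pt k}) D.r_pos, isSpiked_of_near_spikes D.r_pos hG
    (fun _ => Finset.singleton_nonempty _) fun x => by simpa using D.ω_pos.le⟩

end SpikeGrid

/-! ### Barriers beside a spike -/

lemma eventually_mul_le (C : ℝ) {κ : ℝ} (hκ : 0 < κ) : ∀ᶠ δ in 𝓝[>] (0 : ℝ), C * δ ≤ κ := by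
  have hlim : Tendsto (fun δ => C * δ) (𝓝 0) (𝓝 0) :=
    (continuous_const_mul C).tendsto' 0 0 (mul_zero C)
  exact eventually_nhdsWithin_of_eventually_nhds (hlim.eventually_le_const hκ)

lemma eventually_mul_mesh_lt (C : ℝ) {κ : ℝ} (hκ : 0 < κ) :
    ∀ᶠ R : ℕ in atTop, C * mesh R < κ := by
  have hlim : Tendsto (fun R : ℕ => C * mesh R) atTop (𝓝 0) := by
    simpa [mesh] using (tendsto_inv_atTop_nhds_zero_nat (𝕜 := ℝ)).const_mul C
  exact hlim.eventually_lt_const hκ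

lemma exists_forall_dist_le_abs_sub_le (g : C(I, ℝ)) {κ : ℝ} (hκ : 0 < κ) :
    ∃ ρ > 0, ∀ x y, dist x y ≤ ρ → |g x - g y| ≤ κ := by
  obtain ⟨ρ, hρ, h⟩ := Metric.uniformContinuous_iff.1
    (CompactSpace.uniformContinuous_of_continuous g.continuous) κ hκ
  exact ⟨ρ / 2, half_pos hρ, fun x y hxy => (h (by linarith)).le⟩

namespace SpikeGrid

variable (D : SpikeGrid)

/-- On one side of the `k`-th spike, all functions of the family described by `D` stay, up to the
distance `c⁻¹`, below the lines of slope `c` through the top of the spike, with a margin `μ` off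
the ball around `k/R`. -/
def HasBarrier (k : Fin (D.R + 1)) (c μ : ℝ) : Prop :=
  ∃ d, (∀ p, dist p (D.pt k) ≤ D.r → HasRoom d c⁻¹ p) ∧
    ∀ f, D.IsSpiked f → ∀ p y, dist p (D.pt k) ≤ D.r → D.r < dist y (D.pt k) →
      0 ≤ ahead d p y → ahead d p y ≤ c⁻¹ →
        sgn k * f y ≤ sgn k * D.g (D.pt k) + D.A + c * ahead d p y - μ

/-- The tolerances of `D` are so small that a slope bound `c ≤ M - τ` of one function of the family
at a spike yields, at the same spike, a slope bound `c + τ` for all of them. -/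
structure IsSharp (M τ : ℝ) : Prop where
  resolves : D.Resolves M
  ω_le : 32 * D.ω ≤ τ * mesh D.R
  r_le : 4 * M * D.r ≤ D.ω
  osc_le : ∀ x y, dist x y ≤ 2 * D.r → |D.g x - D.g y| ≤ D.ω

variable {D} {f f₀ f' : C(I, ℝ)} {d : ℤˣ} {c c' δ μ M τ : ℝ} {k : Fin (D.R + 1)} {p x y : I}

theorem HasBarrier.exists_mem_slopeBounded (h : D.HasBarrier k c μ) (hf : D.IsSpiked f)
    (hc' : 1 ≤ c') (hcc' : c ≤ c') (hδ : 0 < δ) (hcδ : c'⁻¹ + δ ≤ c⁻¹)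
    (hp : dist p (D.pt k) ≤ D.r) (hpeak : sgn k * f p = sgn k * D.g (D.pt k) + D.A)
    (htop : ∀ y, dist y (D.pt k) ≤ D.r → sgn k * f y ≤ sgn k * D.g (D.pt k) + D.A)
    (hf' : ∀ y, |f' y - f y| < min μ δ / 2) : ∃ x ∈ slopeBounded c' f', dist x p < δ := by
  obtain ⟨d, hroom, hbarrier⟩ := h
  have hbelow (y) (hδy : δ ≤ ahead d p y) (hyc : ahead d p y ≤ c⁻¹) :
      sgn k * f y ≤ sgn k * f p + c' * ahead d p y - min μ δ := by
    rw [hpeak]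
    rcases le_or_gt (dist y (D.pt k)) D.r with hy | hy
    · have := mul_le_mul hc' hδy hδ.le (by linarith)
      linarith [htop y hy, min_le_right μ δ]
    · have := mul_le_mul_of_nonneg_right hcc' (hδ.le.trans hδy)
      linarith [hbarrier f hf p y hp hy (by linarith) hyc, min_le_left μ δ]
  obtain ⟨x, hx, hxp⟩ :=
    exists_mem_slopeBoundedSide_near (by linarith) (hroom p hp) hδ hcδ hbelow hf'
  exact ⟨x, mem_slopeBounded.2 ⟨_, _, hx⟩, hxp⟩

theorem hasBarrier_of_four_mul_le (hc : 4 * (D.R : ℝ) ≤ c) : D.HasBarrier k c D.ω := by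
  have hR : (0 : ℝ) < D.R := Nat.cast_pos.2 D.R_pos
  have hinv : c⁻¹ ≤ mesh D.R / 4 := by
    rw [mesh, div_eq_inv_mul, ← mul_inv]
    exact inv_anti₀ (by positivity) hc
  have hr := D.r_le
  have hr0 := D.r_pos
  have hmesh := D.mesh_pos
  have hc0 : 0 < c := by linarith
  have hball {p} (d : ℤˣ) (hp : dist p (D.pt k) ≤ D.r) :=
    abs_le.1 ((abs_ahead d (D.pt k) p).trans_le ((dist_comm _ _).trans_le hp))
  obtain ⟨d, hd⟩ := exists_hasRoom (w := mesh D.R / 2) (by positivity)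
    (by linarith [mesh_le_one (R := D.R)]) (D.pt k)
  refine ⟨d, fun p hp => hd.mono (by positivity) (by linarith [hball d hp]),
    fun f hf p y hp hy h0 h1 => ?_⟩
  have hyp : dist y p ≤ mesh D.R / 4 := by
    rw [dist_comm, ← abs_ahead d, abs_of_nonneg h0]; linarith
  have hlow := hf.le_of_dist_le hy (by linarith [dist_triangle y p (D.pt k)])
  linarith [mul_nonneg hc0.le h0, D.ω_le, D.A_pos]

namespace IsSharp

variable (hD : D.IsSharp M τ)

include hD

lemma inv_add_lt (hτ : 0 < τ) (hc : 0 < c) (hcM : c + τ ≤ M) :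
    (c + τ)⁻¹ + 4 * D.r < c⁻¹ := by
  have hM : 0 < M := by linarith
  have hr : 4 * D.r * (M * M) < τ := by
    nlinarith [mul_le_mul_of_nonneg_left hD.r_le hM.le, mul_le_mul_of_nonneg_left hD.ω_le hM.le,
      mul_lt_mul_of_pos_left hD.resolves.1 hτ]
  have hprod : 4 * D.r < τ / (c * (c + τ)) := by
    rw [lt_div_iff₀ (by positivity)]
    refine lt_of_le_of_lt ?_ hr
    have := D.r_pos
    gcongr; linarith
  have hdiff : c⁻¹ - (c + τ)⁻¹ = τ / (c * (c + τ)) := by field_simp; ring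
  linarith

/-- Since `f` is close to `f₀` up to a shift by `2 r`, the bound of `f₀` along its window passes to
`f` at the cost of a multiple of `ω`, which the extra slope `τ` pays for outside the ball of radius
`mesh / 2`; inside that ball no function of the family comes near the top of the spike. -/
theorem hasBarrier_of_mem_slopeBoundedSide (hτ : 0 < τ) (hc : 0 < c) (hcM : c + τ ≤ M)
    (hf₀ : D.IsSpiked f₀) (hx : dist x (D.pt k) ≤ D.r) (hxb : x ∈ slopeBoundedSide (sgn k) d c f₀) :
    D.HasBarrier k (c + τ) D.ω := by
  obtain ⟨hroom, hslope⟩ := hxb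
  have hr := D.r_le
  have hr0 := D.r_pos
  have hgap := hD.inv_add_lt hτ hc hcM
  have hshift {y z : I} (h : dist y z ≤ 2 * D.r) := abs_le.1 ((abs_ahead d y z).trans_le h)
  have hxp {p} (hp : dist p (D.pt k) ≤ D.r) : dist x p ≤ 2 * D.r := by
    linarith [dist_triangle_right x p (D.pt k)]
  refine ⟨d, fun p hp => hroom.mono (by positivity) (by linarith [hshift (hxp hp)]),
    fun f hf p y hp hy h0 h1 => ?_⟩
  rcases le_or_gt (dist y (D.pt k)) (mesh D.R / 2) with hnear | hfar
  · have hlow := hf.le_of_dist_le hy hnear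
    linarith [mul_nonneg (add_pos hc hτ).le h0, D.ω_le, D.A_pos]
  obtain ⟨z, hzy, hz⟩ := hf.exists_near_le hf₀ D.ω_pos.le hD.osc_le (sgn k) y
  have hpy : mesh D.R / 2 - D.r < ahead d p y := by
    rw [← abs_of_nonneg h0, abs_ahead]
    linarith [dist_triangle_left y (D.pt k) p]
  have hz' := hshift ((dist_comm y z).trans_le hzy)
  have hp' := hshift (hxp hp)
  have hxz : ahead d x z = ahead d x p + ahead d p y + ahead d y z := by
    rw [ahead_add, ahead_add]
  have hrise := hslope z (by linarith) (by linarith)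
  rw [mul_sub] at hrise
  have hcost : c * ahead d x z ≤ c * ahead d p y + D.ω := by
    have hstep : c * ahead d x z ≤ c * (ahead d p y + 4 * D.r) := by gcongr; linarith
    have hcr : c * (4 * D.r) ≤ M * (4 * D.r) := by gcongr; linarith
    linarith [hD.r_le]
  have hgain : 8 * D.ω ≤ τ * ahead d p y := by
    have : τ * (mesh D.R / 4) ≤ τ * ahead d p y := by gcongr; linarith
    linarith [hD.ω_le]
  linarith [hf₀.upper k x hx, D.ω_pos]

end IsSharp

theorem exists_isSharp {U : Set C(I, ℝ)} (hU : IsOpen U) (hne : U.Nonempty) (M : ℝ) {τ ε : ℝ}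
    (hτ : 0 < τ) (hε : 0 < ε) :
    ∃ D : SpikeGrid, (∀ f, D.IsSpiked f → f ∈ U) ∧ D.IsSharp M τ ∧ D.r ≤ ε := by
  obtain ⟨g, hg⟩ := hne
  obtain ⟨A', hA', hball⟩ := Metric.isOpen_iff.1 hU g hg
  set A := A' / 3 with hA
  have hA0 : 0 < A := by positivity
  obtain ⟨ρ, hρ, hosc⟩ := exists_forall_dist_le_abs_sub_le g (by positivity : 0 < A / 8)
  obtain ⟨R, hR, hR3, hRM, hRA⟩ := ((eventually_gt_atTop 0).and
    ((eventually_mul_mesh_lt 3 hρ).and ((eventually_mul_mesh_lt (3 * M) one_pos).and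
      (eventually_mul_mesh_lt (24 * M) hA0)))).exists
  have hmesh := KnotPoints.mesh_pos hR
  set ω := min (A / 16) (τ * mesh R / 32)
  have hω : 0 < ω := lt_min (by positivity) (by positivity)
  obtain ⟨ρ', hρ', hosc'⟩ := exists_forall_dist_le_abs_sub_le g hω
  obtain ⟨r, hr0, hr, hrε, hrM, hrρ⟩ := (eventually_mem_nhdsWithin.and
    ((eventually_mul_le 32 hmesh).and ((eventually_mul_le 1 hε).and
      ((eventually_mul_le (4 * M) hω).and (eventually_mul_le 2 hρ'))))).exists
  let D : SpikeGrid :=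
    { g := g, R := R, A := A, ω := ω, r := r
      R_pos := hR, A_pos := hA0, ω_pos := hω, r_pos := hr0
      ω_le := min_le_left _ _
      r_le := by linarith
      osc_le := fun x y h => hosc x y (h.trans hR3.le) }
  refine ⟨D, fun f hf => hball (hf.dist_le.trans_lt (by change 2 * A < A'; linarith)),
    ⟨⟨hRM, hRA.le⟩, ?_, hrM, fun x y h => hosc' x y (h.trans hrρ)⟩, by linarith⟩
  linarith [min_le_right (A / 16) (τ * mesh R / 32)]

end SpikeGrid

/-! ### Positions of the game -/

/-- Bounds `e i` on slopes for the indices `i < N`, relaxed by an amount `θ` which grows during the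
game but stays below `1`. -/
structure SlopeBudget where
  N : ℕ
  e : ℕ → ℝ
  θ : ℝ
  θ_nonneg : 0 ≤ θ
  θ_lt_one : θ < 1
  succ_le : ∀ i < N, (i : ℝ) + 1 ≤ e i

namespace SlopeBudget

variable (B : SlopeBudget) {N' i : ℕ} {E : ℝ}

/-- The slope currently allowed at the index `i`. -/
def slope (i : ℕ) : ℝ := B.e i + B.θ

/-- The amount by which the slopes of `B` are relaxed when `B` is extended. -/
noncomputable def slack : ℝ := (1 - B.θ) / 2

/-- `B'` has more indices than `B`, and the same bounds for the indices of `B`. -/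
structure ExtendedBy (B' : SlopeBudget) : Prop where
  N_le : B.N ≤ B'.N
  e_eq : ∀ i < B.N, B'.e i = B.e i

/-- The budget `B` with relaxed slopes, extended by the bound `E` for the indices from `B.N` on. -/
noncomputable def extend (N' : ℕ) {E : ℝ} (hE : (N' : ℝ) ≤ E) : SlopeBudget where
  N := N'
  e i := if i < B.N then B.e i else E
  θ := B.θ + B.slack
  θ_nonneg := by rw [slack]; linarith [B.θ_nonneg, B.θ_lt_one]
  θ_lt_one := by rw [slack]; linarith [B.θ_lt_one]
  succ_le i hi := by
    split_ifs with h
    · exact B.succ_le i h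
    · have : (i : ℝ) + 1 ≤ N' := by exact_mod_cast hi
      exact this.trans hE

variable {B}

lemma slack_pos : 0 < B.slack := half_pos (sub_pos.2 B.θ_lt_one)

lemma e_le_slope : B.e i ≤ B.slope i := le_add_of_nonneg_right B.θ_nonneg

lemma slope_lt : B.slope i < B.e i + 1 := by rw [slope]; linarith [B.θ_lt_one]

lemma one_le_slope (hi : i < B.N) : 1 ≤ B.slope i := by
  linarith [B.succ_le i hi, B.e_le_slope (i := i), Nat.cast_nonneg (α := ℝ) i]

lemma ExtendedBy.trans {B B' B'' : SlopeBudget} (h : B.ExtendedBy B') (h' : B'.ExtendedBy B'') :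
    B.ExtendedBy B'' :=
  ⟨h.N_le.trans h'.N_le, fun i hi => (h'.e_eq i (hi.trans_le h.N_le)).trans (h.e_eq i hi)⟩

lemma extendedBy_extend (hN : B.N ≤ N') (hE : (N' : ℝ) ≤ E) : B.ExtendedBy (B.extend N' hE) :=
  ⟨hN, fun _ hi => if_pos hi⟩

lemma extend_slope_of_lt (hE : (N' : ℝ) ≤ E) (hi : i < B.N) :
    (B.extend N' hE).slope i = B.slope i + B.slack := by
  simp only [slope, extend, if_pos hi, add_assoc]

lemma le_extend_slope (hE : (N' : ℝ) ≤ E) (hi : B.N ≤ i) : E ≤ (B.extend N' hE).slope i :=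
  calc E = (B.extend N' hE).e i := (if_neg hi.not_gt).symm
    _ ≤ (B.extend N' hE).slope i := e_le_slope

end SlopeBudget

/-- A position of the game given by an open set `U` of functions having, `δ`-close to each point
of `F i`, a point at which their slopes are bounded by the budget. -/
structure PinnedPosition extends SlopeBudget where
  F : ℕ → Finset I
  δ : ℝ
  U : Set C(I, ℝ)
  isOpen_U : IsOpen U
  nonempty_U : U.Nonempty
  δ_pos : 0 < δ
  sep : ∀ i < N, ∀ j < N, i ≠ j → ∀ p ∈ F i, ∀ q ∈ F j, 4 * δ < dist p q
  forced : ∀ i < N, ∀ p ∈ F i, ∀ f ∈ U, ∃ x ∈ slopeBounded (toSlopeBudget.slope i) f, dist x p ≤ δ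

/-- The sequences of closed sets admitted by a pinned position. -/
def PinnedPosition.V (b : PinnedPosition) : Set (ℕ → Closeds I) := cylinder b.N b.F (2 * b.δ)

lemma PinnedPosition.isOpen_V (b : PinnedPosition) : IsOpen b.V := isOpen_cylinder _ _ _

lemma PinnedPosition.nonempty_V (b : PinnedPosition) : b.V.Nonempty :=
  ⟨_, ofFinset_mem_cylinder _ _ (mul_pos two_pos b.δ_pos)⟩

/-- A position of the game given by a grid of spikes, the `k`-th of which is assigned to the index
`ℓ k` and has a barrier of the slope allowed there. -/
structure SpikedPosition extends SpikeGrid, SlopeBudget where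
  ℓ : Fin (R + 1) → ℕ
  μ : ℝ
  μ_pos : 0 < μ
  resolves : toSpikeGrid.Resolves N
  barrier : ∀ k, ℓ k < N → toSpikeGrid.HasBarrier k (toSlopeBudget.slope (ℓ k)) μ

namespace SpikedPosition

variable (c : SpikedPosition)

/-- The points of the grid assigned to the index `i`. -/
noncomputable def centers (i : ℕ) : Finset I :=
  open Classical in (Finset.univ.filter fun k => c.ℓ k = i).image c.pt

/-- The functions admitted by a spiked position. -/
def U : Set C(I, ℝ) := {f | c.IsSpiked f}

/-- The sequences of closed sets admitted by a spiked position. -/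
def V : Set (ℕ → Closeds I) := cylinder c.N c.centers c.r

lemma isOpen_V : IsOpen c.V := isOpen_cylinder _ _ _

lemma nonempty_V : c.V.Nonempty :=
  ⟨_, ofFinset_mem_cylinder _ _ c.r_pos⟩

/-- The point `x` lies in the ball around a grid point assigned to the index `i`. -/
def Marks (i : ℕ) (x : I) : Prop := i < c.N ∧ ∃ k, c.ℓ k = i ∧ dist x (c.pt k) ≤ c.r

/-- The relation between a spiked position and the pinned positions that may follow it: in the balls
marked `i`, the points of bounded slope are close to the finite set `F i`. -/
structure RefinedBy (b : PinnedPosition) : Prop where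
  U_subset : b.U ⊆ c.U
  V_subset : b.V ⊆ c.V
  extendedBy : c.ExtendedBy b.toSlopeBudget
  δ_le : b.δ ≤ 1 / (b.N + 1)
  exists_dist_le : ∀ f ∈ b.U, ∀ i x, c.Marks i x → ∀ s : ℝ, 0 < s → s ≤ c.N →
    x ∈ slopeBounded s f → ∃ p ∈ b.F i, dist x p ≤ b.δ

variable {c} {i : ℕ} {p : I}

lemma mem_centers : p ∈ c.centers i ↔ ∃ k, c.ℓ k = i ∧ c.pt k = p := by
  simp [centers]

end SpikedPosition

/-- The relation between a pinned position and the spiked positions that may follow it: all points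
of bounded slope are marked, and the old indices keep those close to their finite sets. -/
structure PinnedPosition.RefinedBy (b : PinnedPosition) (c : SpikedPosition) : Prop where
  U_subset : c.U ⊆ b.U
  V_subset : c.V ⊆ b.V
  extendedBy : b.ExtendedBy c.toSlopeBudget
  N_lt : b.N < c.N
  exists_marks : ∀ f ∈ c.U, ∀ s : ℝ, 0 < s → s ≤ c.N → ∀ x ∈ slopeBounded s f, ∃ i, c.Marks i x
  marks : ∀ f ∈ c.U, ∀ i < b.N, ∀ s : ℝ, 0 < s → s ≤ b.e i → ∀ x ∈ slopeBounded s f,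
    ∀ p ∈ b.F i, dist x p ≤ b.δ → c.Marks i x

/-! ### Answering a spiked position -/

lemma exists_mem_slopeBounded_near_of_le {f f' : C(I, ℝ)} {s δ : ℝ} (hs : 4 ≤ s) (hδ : 0 < δ)
    (hδ' : δ ≤ 1 / 4) (hfs : 2 * ‖f‖ + δ ≤ s * δ) (hf' : ∀ y, |f' y - f y| < δ / 2) (p : I) :
    ∃ x ∈ slopeBounded s f', dist x p < δ := by
  have hinv : s⁻¹ ≤ 4⁻¹ := inv_anti₀ (by norm_num) hs
  obtain ⟨d, hroom⟩ := exists_hasRoom (w := 1 / 2) (by norm_num) le_rfl p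
  have hbelow (y) (hy : δ ≤ ahead d p y) (_ : ahead d p y ≤ 1 / 2) :
      ((1 : ℤˣ) : ℝ) * f y ≤ ((1 : ℤˣ) : ℝ) * f p + s * ahead d p y - δ := by
    have hrise : s * δ ≤ s * ahead d p y := by gcongr
    have hy' := abs_le.1 (f.norm_coe_le_norm y)
    have hp' := abs_le.1 (f.norm_coe_le_norm p)
    simp only [Units.val_one, Int.cast_one, one_mul]
    linarith
  obtain ⟨x, hx, hxp⟩ := exists_mem_slopeBoundedSide_near (by linarith) hroom hδ
    (by linarith) hbelow hf'
  exact ⟨x, mem_slopeBounded.2 ⟨_, _, hx⟩, hxp⟩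

namespace SpikedPosition

variable (c : SpikedPosition) {N i : ℕ} {F : ℕ → Finset I} {δ E : ℝ} {k : Fin (c.R + 1)}
  {p x : I} {f : C(I, ℝ)}

/-- The points of the `k`-th ball at which the `k`-th spike is to reach its full height, in order
to force slopes to be bounded near the points of the sets `F i`. -/
noncomputable def targets (F : ℕ → Finset I) (k : Fin (c.R + 1)) : Finset I :=
  open Classical in
  if c.ℓ k < c.N then (F (c.ℓ k)).filter fun p => dist p (c.pt k) < c.r else {c.pt k}

/-- The finite sets `F i` and the tolerance `δ` are suitable for a pinned position following `c`. -/
structure IsPinning (N : ℕ) (F : ℕ → Finset I) (δ : ℝ) : Prop where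
  N_le : c.N ≤ N
  mem_V : (fun i => ofFinset (F i)) ∈ c.V
  sep : ∀ i < N, ∀ j < N, i ≠ j → ∀ p ∈ F i, ∀ q ∈ F j, 4 * δ < dist p q
  targets_le : ∀ k, ∀ p ∈ c.targets F k, dist p (c.pt k) + δ ≤ c.r
  inv_add_le : ∀ i < c.N, (c.slope i + c.slack)⁻¹ + δ ≤ (c.slope i)⁻¹
  δ_pos : 0 < δ
  δ_le : δ ≤ 1 / (N + 1)
  δ_le_quarter : δ ≤ 1 / 4

variable {c}

lemma targets_of_lt (hk : c.ℓ k < c.N) (hp : p ∈ c.targets F k) :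
    p ∈ F (c.ℓ k) ∧ dist p (c.pt k) < c.r := by
  classical
  rw [targets, if_pos hk] at hp
  exact Finset.mem_filter.1 hp

lemma mem_targets (hk : c.ℓ k < c.N) (hp : p ∈ F (c.ℓ k)) (hpk : dist p (c.pt k) < c.r) :
    p ∈ c.targets F k := by
  classical
  rw [targets, if_pos hk]
  exact Finset.mem_filter.2 ⟨hp, hpk⟩

lemma dist_lt_of_mem_targets (hp : p ∈ c.targets F k) : dist p (c.pt k) < c.r := by
  by_cases hk : c.ℓ k < c.N
  · exact (targets_of_lt hk hp).2
  · rw [targets, if_neg hk, Finset.mem_singleton] at hp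
    rw [hp, dist_self]
    exact c.r_pos

lemma targets_nonempty (hF : (fun i => ofFinset (F i)) ∈ c.V) (k : Fin (c.R + 1)) :
    (c.targets F k).Nonempty := by
  by_cases hk : c.ℓ k < c.N
  · obtain ⟨p, hp, hpk⟩ := exists_mem_dist_lt_of_mem_cylinder hF hk (mem_centers.2 ⟨k, rfl, rfl⟩)
    exact ⟨p, mem_targets hk hp hpk⟩
  · rw [targets, if_neg hk]
    exact Finset.singleton_nonempty _

lemma exists_mem_targets (hF : (fun i => ofFinset (F i)) ∈ c.V) (hi : i < c.N) (hp : p ∈ F i) :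
    ∃ k, c.ℓ k = i ∧ p ∈ c.targets F k := by
  obtain ⟨_, hq, hpq⟩ := exists_dist_lt_of_mem_cylinder hF hi hp
  obtain ⟨k, rfl, rfl⟩ := mem_centers.1 hq
  exact ⟨k, rfl, mem_targets hi hp hpq⟩

theorem exists_isPinning {W : Set (ℕ → Closeds I)} (hW : IsOpen W) (hne : W.Nonempty)
    (hWc : W ⊆ c.V) : ∃ N F δ, c.IsPinning N F δ ∧ cylinder N F (2 * δ) ⊆ W := by
  obtain ⟨N, hN, F, hF, δ₀, hδ₀, hsub⟩ := exists_cylinder_subset hW hne c.N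
  have hsep : ∀ᶠ δ in 𝓝[>] (0 : ℝ), ∀ i < N, ∀ j < N, i ≠ j → ∀ p ∈ F i, ∀ q ∈ F j,
      5 * δ ≤ dist p q := by
    refine (Set.finite_Iio N).eventually_all.2 fun i hi =>
      (Set.finite_Iio N).eventually_all.2 fun j hj => ?_
    by_cases hij : i = j
    · simp [hij]
    simp only [ne_eq, hij, not_false_eq_true, forall_const]
    refine (Filter.eventually_all_finset _).2 fun p hp =>
      (Filter.eventually_all_finset _).2 fun q hq => eventually_mul_le 5 (dist_pos.2 ?_)
    rintro rfl
    exact Finset.disjoint_left.1 (hF hi hj hij) hp hq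
  have htargets : ∀ᶠ δ in 𝓝[>] (0 : ℝ), ∀ k, ∀ p ∈ c.targets F k, 1 * δ ≤ c.r - dist p (c.pt k) :=
    Filter.eventually_all.2 fun k => (Filter.eventually_all_finset _).2 fun p hp =>
      eventually_mul_le 1 (sub_pos.2 (dist_lt_of_mem_targets hp))
  have hinv : ∀ᶠ δ in 𝓝[>] (0 : ℝ), ∀ i < c.N,
      1 * δ ≤ (c.slope i)⁻¹ - (c.slope i + c.slack)⁻¹ :=
    (Set.finite_Iio c.N).eventually_all.2 fun i hi => eventually_mul_le 1 <| sub_pos.2 <|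
      inv_strictAnti₀ (zero_lt_one.trans_le (c.one_le_slope hi))
        (lt_add_of_pos_right _ c.slack_pos)
  obtain ⟨δ, hδ, hδW, hsep, htargets, hinv, hδN, hδ4⟩ := (eventually_mem_nhdsWithin.and
    ((eventually_mul_le 2 hδ₀).and (hsep.and (htargets.and (hinv.and
      ((eventually_mul_le 1 (by positivity : (0 : ℝ) < 1 / (N + 1))).and
        (eventually_mul_le 1 (by norm_num : (0 : ℝ) < 1 / 4)))))))).exists
  have hδ' : 0 < δ := hδ
  refine ⟨N, F, δ, ⟨hN, hWc (hsub _ hδW (ofFinset_mem_cylinder N F (by positivity))),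
    fun i hi j hj hij p hp q hq => ?_, fun k p hp => ?_, fun i hi => ?_, hδ, ?_, ?_⟩, hsub _ hδW⟩
  · linarith [hsep i hi j hj hij p hp q hq]
  · linarith [htargets k p hp]
  · linarith [hinv i hi]
  · linarith
  · linarith

namespace IsPinning

variable (h : c.IsPinning N F δ)

include h

lemma isSpiked (hf : ∀ y, |f y - c.spikes (c.targets F) h.δ_pos y| ≤ c.ω) : c.IsSpiked f :=
  SpikeGrid.isSpiked_of_near_spikes h.δ_pos h.targets_le (targets_nonempty h.mem_V) hf

lemma exists_mem_slopeBounded_of_lt (hi : i < c.N) (hp : p ∈ F i)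
    (hf : ∀ y, |f y - c.spikes (c.targets F) h.δ_pos y| < min c.μ δ / 2) :
    ∃ x ∈ slopeBounded (c.slope i + c.slack) f, dist x p < δ := by
  obtain ⟨k, rfl, hpk⟩ := exists_mem_targets h.mem_V hi hp
  have hslack := c.slack_pos
  have hspiked := h.isSpiked (f := c.spikes (c.targets F) h.δ_pos)
    fun y => by simpa using c.ω_pos.le
  exact (c.barrier k hi).exists_mem_slopeBounded hspiked (by linarith [c.one_le_slope hi])
    (by linarith) h.δ_pos (h.inv_add_le _ hi) (dist_lt_of_mem_targets hpk).le
    (SpikeGrid.sgn_mul_spikes_of_mem h.δ_pos h.targets_le hpk)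
    (fun y hy => (SpikeGrid.sgn_mul_spikes_mem_Icc h.δ_pos h.targets_le hy).2) hf

lemma exists_mem_slopeBounded_extend (hNE : (N : ℝ) ≤ E) (hE : 4 ≤ E)
    (hEδ : 2 * ‖c.spikes (c.targets F) h.δ_pos‖ + δ ≤ E * δ) (hp : p ∈ F i)
    (hf : ∀ y, |f y - c.spikes (c.targets F) h.δ_pos y| < min c.μ δ / 2) :
    ∃ x ∈ slopeBounded ((c.extend N hNE).slope i) f, dist x p ≤ δ := by
  rcases lt_or_ge i c.N with hi | hi
  · obtain ⟨x, hx, hxp⟩ := h.exists_mem_slopeBounded_of_lt hi hp hf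
    exact ⟨x, by rwa [SlopeBudget.extend_slope_of_lt hNE hi], hxp.le⟩
  · have hs := SlopeBudget.le_extend_slope hNE hi
    obtain ⟨x, hx, hxp⟩ := exists_mem_slopeBounded_near_of_le (hE.trans hs) h.δ_pos h.δ_le_quarter
      (hEδ.trans (mul_le_mul_of_nonneg_right hs h.δ_pos.le))
      (fun y => (hf y).trans_le (by linarith [min_le_right c.μ δ])) p
    exact ⟨x, hx, hxp.le⟩

/-- Away from the targets of its ball, such a function is as flat as off the spikes. -/
lemma exists_dist_le (hf : ∀ y, |f y - c.spikes (c.targets F) h.δ_pos y| ≤ c.ω)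
    (hx : c.Marks i x) {s : ℝ} (hs : 0 < s) (hsN : s ≤ c.N) (hxs : x ∈ slopeBounded s f) :
    ∃ p ∈ F i, dist x p ≤ δ := by
  obtain ⟨hi, k, rfl, hxk⟩ := hx
  by_contra! hfar
  refine (h.isSpiked hf).notMem_slopeBounded hs (c.resolves.mono hsN) ?_ hxs
  rw [← SpikeGrid.spikes_of_le_dist (G := c.targets F) h.δ_pos fun l p hp => ?_]
  · exact hf x
  by_contra! hlt
  obtain rfl : l = k := SpikeGrid.eq_of_dist_le (SpikeGrid.dist_le_half_mesh (by
    linarith [h.targets_le l p hp, dist_triangle x p (c.pt l)])) hxk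
  exact (hfar p (targets_of_lt hi hp).1).not_gt hlt

end IsPinning

theorem exists_refinedBy {W : Set (ℕ → Closeds I)} (hW : IsOpen W) (hne : W.Nonempty)
    (hWc : W ⊆ c.V) : ∃ b, c.RefinedBy b ∧ b.V ⊆ W := by
  obtain ⟨N, F, δ, h, hsub⟩ := exists_isPinning hW hne hWc
  have hδ := h.δ_pos
  set f := c.spikes (c.targets F) hδ
  set ε := min c.ω (min c.μ δ / 2)
  have hε : 0 < ε := lt_min c.ω_pos (half_pos (lt_min c.μ_pos hδ))
  have hnear {f'} (hf' : f' ∈ Metric.ball f ε) (y) : |f' y - f y| < ε :=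
    (ContinuousMap.dist_apply_le_dist y).trans_lt hf'
  have hω {f'} (hf' : f' ∈ Metric.ball f ε) (y) : |f' y - f y| ≤ c.ω :=
    (hnear hf' y).le.trans (min_le_left _ _)
  obtain ⟨E, hNE, hE, hEf⟩ : ∃ E : ℝ, N ≤ E ∧ 4 ≤ E ∧ 2 * ‖f‖ / δ + 1 ≤ E :=
    ((eventually_ge_atTop _).and ((eventually_ge_atTop _).and (eventually_ge_atTop _))).exists
  have hEδ : 2 * ‖f‖ + δ ≤ E * δ := by
    rwa [← div_le_iff₀ hδ, add_div, div_self hδ.ne']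
  let b : PinnedPosition :=
    { c.extend N hNE with
      F := F, δ := δ, U := Metric.ball f ε
      isOpen_U := Metric.isOpen_ball
      nonempty_U := ⟨f, Metric.mem_ball_self hε⟩
      δ_pos := hδ
      sep := h.sep
      forced := fun _ _ _ hp _ hf' => h.exists_mem_slopeBounded_extend hNE hE hEδ hp
        fun y => (hnear hf' y).trans_le (min_le_right _ _) }
  exact ⟨b, ⟨fun _ hf' => h.isSpiked (hω hf'), hsub.trans hWc,
    SlopeBudget.extendedBy_extend h.N_le hNE, h.δ_le,
    fun _ hf' _ _ hx _ hs hsN hxs => h.exists_dist_le (hω hf') hx hs hsN hxs⟩, hsub⟩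

end SpikedPosition

/-! ### Answering a pinned position -/

namespace PinnedPosition

variable {b : PinnedPosition} {D : SpikeGrid} {i j : ℕ} {k : Fin (D.R + 1)} {M : ℝ}
  {p x : I} {f : C(I, ℝ)}

/-- Some function of the family described by `D` has, near a point of `F i`, a point in the `k`-th
ball at which its slopes are bounded by the budget of `b`. -/
structure Claims (b : PinnedPosition) (D : SpikeGrid) (k : Fin (D.R + 1)) (i : ℕ) : Prop where
  lt : i < b.N
  exists_dist_le : ∃ p ∈ b.F i, dist p (D.pt k) ≤ b.δ + D.r
  exists_mem_slopeBounded : ∃ f, D.IsSpiked f ∧ ∃ x ∈ slopeBounded (b.slope i) f,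
    dist x (D.pt k) ≤ D.r

namespace Claims

lemma unique (hr : D.r ≤ b.δ) (hi : b.Claims D k i) (hj : b.Claims D k j) : i = j := by
  by_contra hij
  obtain ⟨p, hp, hpk⟩ := hi.exists_dist_le
  obtain ⟨q, hq, hqk⟩ := hj.exists_dist_le
  linarith [b.sep i hi.lt j hj.lt hij p hp q hq, dist_triangle_right p q (D.pt k)]

lemma hasBarrier (hD : D.IsSharp M b.slack) (hM : ∀ i < b.N, b.slope i + b.slack ≤ M)
    (h : b.Claims D k i) : D.HasBarrier k (b.slope i + b.slack) D.ω := by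
  obtain ⟨f, hf, x, hx, hxk⟩ := h.exists_mem_slopeBounded
  obtain ⟨σ, d, hx⟩ := mem_slopeBounded.1 hx
  have hs : 0 < b.slope i := zero_lt_one.trans_le (b.one_le_slope h.lt)
  have hsM := hM i h.lt
  obtain rfl := hf.eq_sgn_of_mem_slopeBoundedSide hs
    (hD.resolves.mono (by linarith [b.slack_pos])) hxk hx
  exact hD.hasBarrier_of_mem_slopeBoundedSide b.slack_pos hs hsM hf hxk hx

lemma exists_of_mem_slopeBounded (hD : D.Resolves M) (hf : D.IsSpiked f) (hi : i < b.N) {s : ℝ}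
    (hs : 0 < s) (hsi : s ≤ b.slope i) (hiM : b.slope i ≤ M) (hx : x ∈ slopeBounded s f)
    (hp : p ∈ b.F i) (hxp : dist x p ≤ b.δ) : ∃ k, b.Claims D k i ∧ dist x (D.pt k) ≤ D.r := by
  obtain ⟨k, hk⟩ := hf.exists_dist_pt_lt hs (hD.mono (hsi.trans hiM)) hx
  exact ⟨k, ⟨hi, ⟨p, hp, by linarith [dist_triangle_left p (D.pt k) x]⟩,
    f, hf, x, slopeBounded_mono hs hsi hx, hk.le⟩, hk.le⟩

end Claims

/-- The label of a grid point: the index claiming it, if there is one, and the new index `b.N`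
otherwise. -/
noncomputable def label (b : PinnedPosition) (D : SpikeGrid) (k : Fin (D.R + 1)) : ℕ :=
  open Classical in if h : ∃ i, b.Claims D k i then h.choose else b.N

lemma label_eq_of_claims (hr : D.r ≤ b.δ) (h : b.Claims D k i) : b.label D k = i := by
  have hex : ∃ i, b.Claims D k i := ⟨i, h⟩
  rw [label, dif_pos hex]
  exact hex.choose_spec.unique hr h

lemma claims_label_or_eq (b : PinnedPosition) (D : SpikeGrid) (k : Fin (D.R + 1)) :
    b.Claims D k (b.label D k) ∨ b.label D k = b.N := by
  by_cases hex : ∃ i, b.Claims D k i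
  · exact .inl (by rw [label, dif_pos hex]; exact hex.choose_spec)
  · exact .inr (dif_neg hex)

lemma claims_label (hk : b.label D k < b.N) : b.Claims D k (b.label D k) :=
  (b.claims_label_or_eq D k).resolve_right hk.ne

lemma label_le : b.label D k ≤ b.N :=
  (b.claims_label_or_eq D k).elim (fun h => h.lt.le) Eq.le

/-- The position in which the grid points are assigned to the indices claiming them. -/
noncomputable def answer (b : PinnedPosition) (D : SpikeGrid) (hD : D.IsSharp M b.slack)
    (hNM : (b.N : ℝ) + 1 ≤ M) (hM : ∀ i < b.N, b.slope i + b.slack ≤ M) : SpikedPosition :=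
  { D, b.extend (b.N + 1) (E := max ((b.N + 1 : ℕ) : ℝ) (4 * D.R)) (le_max_left _ _) with
    ℓ := b.label D
    μ := D.ω
    μ_pos := D.ω_pos
    resolves := hD.resolves.mono (by exact_mod_cast hNM)
    barrier := fun k _ => by
      rcases lt_or_ge (b.label D k) b.N with hk | hk
      · rw [SlopeBudget.extend_slope_of_lt _ hk]
        exact (claims_label hk).hasBarrier hD hM
      · exact SpikeGrid.hasBarrier_of_four_mul_le
          ((le_max_right _ _).trans (SlopeBudget.le_extend_slope _ hk)) }

section Answer

variable (hD : D.IsSharp M b.slack) (hNM : (b.N : ℝ) + 1 ≤ M)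
  (hM : ∀ i < b.N, b.slope i + b.slack ≤ M) (hr : 4 * D.r ≤ b.δ)
  (hU : ∀ f, D.IsSpiked f → f ∈ b.U)

include hr hU

lemma edist_centers_answer_le (hi : i < b.N) :
    edist (ofFinset ((b.answer D hD hNM hM).centers i)) (ofFinset (b.F i)) ≤
      ENNReal.ofReal (b.δ + D.r) := by
  have hr0 := D.r_pos
  refine edist_ofFinset_le (fun q hq => ?_) fun p hp => ?_
  · obtain ⟨k, rfl, rfl⟩ := SpikedPosition.mem_centers.1 hq
    obtain ⟨p, hp, hpk⟩ := (claims_label hi).exists_dist_le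
    exact ⟨p, hp, by rwa [dist_comm]⟩
  · obtain ⟨f, hf⟩ := D.exists_isSpiked
    obtain ⟨x, hx, hxp⟩ := b.forced i hi p hp f (hU f hf)
    obtain ⟨k, hk, hxk⟩ := Claims.exists_of_mem_slopeBounded hD.resolves hf hi
      (zero_lt_one.trans_le (b.one_le_slope hi)) le_rfl
      (by linarith [hM i hi, b.slack_pos]) hx hp hxp
    refine ⟨D.pt k, SpikedPosition.mem_centers.2
      ⟨k, label_eq_of_claims (by linarith) hk, rfl⟩, ?_⟩
    linarith [dist_triangle_left (D.pt k) p x]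

theorem refinedBy_answer : b.RefinedBy (b.answer D hD hNM hM) where
  U_subset := hU
  V_subset := cylinder_subset_cylinder b.N.le_succ (by linarith [D.r_pos, b.δ_pos]) D.r_pos.le
    (fun _ hi => edist_centers_answer_le hD hNM hM hr hU hi) (by linarith [b.δ_pos] : D.r + _ ≤ _)
  extendedBy := SlopeBudget.extendedBy_extend b.N.le_succ (le_max_left _ _)
  N_lt := b.N.lt_succ_self
  exists_marks f hf s hs hsN x hx := by
    obtain ⟨k, hk⟩ := hf.exists_dist_pt_lt hs ((b.answer D hD hNM hM).resolves.mono hsN) hx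
    exact ⟨_, Nat.lt_succ_of_le label_le, k, rfl, hk.le⟩
  marks f hf i hi s hs hsi x hx p hp hxp := by
    obtain ⟨k, hk, hxk⟩ := Claims.exists_of_mem_slopeBounded hD.resolves hf hi hs
      (hsi.trans b.e_le_slope) (by linarith [hM i hi, b.slack_pos]) hx hp hxp
    exact ⟨hi.trans b.N.lt_succ_self, k, label_eq_of_claims (by linarith [D.r_pos]) hk, hxk⟩

end Answer

theorem exists_refinedBy {W : Set C(I, ℝ)} (hW : IsOpen W) (hne : W.Nonempty) (hWb : W ⊆ b.U) :
    ∃ c, b.RefinedBy c ∧ c.U ⊆ W := by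
  obtain ⟨M, hNM, hM⟩ : ∃ M : ℝ, b.N + 1 ≤ M ∧ ∀ i ∈ Set.Iio b.N, b.slope i + b.slack ≤ M :=
    ((eventually_ge_atTop _).and ((Set.finite_Iio b.N).eventually_all.2
      fun _ _ => eventually_ge_atTop _)).exists
  obtain ⟨D, hDW, hD, hr⟩ := SpikeGrid.exists_isSharp hW hne M b.slack_pos
    (div_pos b.δ_pos four_pos)
  exact ⟨b.answer D hD hNM hM, refinedBy_answer hD hNM hM (by linarith)
    fun f hf => hWb (hDW f hf), hDW⟩

end PinnedPosition

/-! ### Plays of the game -/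

/-- An infinite play of the game with positions `b 0, c 0, b 1, c 1, …`, converging to the pair
consisting of the function `f` and the sequence `K` of closed sets. -/
structure IsPlay (b : ℕ → PinnedPosition) (c : ℕ → SpikedPosition) (f : C(I, ℝ))
    (K : ℕ → Closeds I) : Prop where
  spiked_refines : ∀ t, (b t).RefinedBy (c t)
  pinned_refines : ∀ t, (c t).RefinedBy (b (t + 1))
  mem_U : ∀ t, f ∈ (b t).U
  mem_V : ∀ t, K ∈ (b t).V

namespace IsPlay

variable {b : ℕ → PinnedPosition} {c : ℕ → SpikedPosition} {f : C(I, ℝ)} {K : ℕ → Closeds I}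
  (h : IsPlay b c f K) {i t : ℕ} {s : ℝ} {x : I}

include h

lemma mem_spiked_U (t : ℕ) : f ∈ (c t).U := (h.pinned_refines t).U_subset (h.mem_U (t + 1))

lemma lt_N (t : ℕ) : t < (c t).N := by
  induction t with
  | zero => exact (Nat.zero_le _).trans_lt (h.spiked_refines 0).N_lt
  | succ t ih =>
    exact (Nat.succ_le_of_lt ih).trans_lt
      ((h.pinned_refines t).extendedBy.N_le.trans_lt (h.spiked_refines (t + 1)).N_lt)

lemma tendsto_δ : Tendsto (fun t => (b (t + 1)).δ) atTop (𝓝 0) := by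
  refine squeeze_zero (fun t => (b (t + 1)).δ_pos.le) (fun t => ?_)
    tendsto_one_div_add_atTop_nhds_zero_nat
  refine (h.pinned_refines t).δ_le.trans (one_div_le_one_div_of_le (by positivity) ?_)
  gcongr
  exact (h.lt_N t).le.trans (h.pinned_refines t).extendedBy.N_le

lemma extendedBy (t : ℕ) : (b t).ExtendedBy (b (t + 1)).toSlopeBudget :=
  (h.spiked_refines t).extendedBy.trans (h.pinned_refines t).extendedBy

lemma extendedBy_of_le {t' : ℕ} (ht : t ≤ t') : (b t).ExtendedBy (b t').toSlopeBudget := by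
  induction t', ht using Nat.le_induction with
  | base => exact ⟨le_rfl, fun _ _ => rfl⟩
  | succ t' _ ih => exact ih.trans (h.extendedBy t')

lemma exists_dist_le_of_marks (hs : 0 < s) (hst : s ≤ (c t).N) (hx : x ∈ slopeBounded s f)
    (hmark : (c t).Marks i x) : i < (b (t + 1)).N ∧ ∃ p ∈ (b (t + 1)).F i,
      dist x p ≤ (b (t + 1)).δ :=
  ⟨hmark.1.trans_le (h.pinned_refines t).extendedBy.N_le,
    (h.pinned_refines t).exists_dist_le f (h.mem_U _) i x hmark s hs hst hx⟩

lemma marks_succ (hs : 0 < s) (hst : s ≤ (c t).N) (hsi : s ≤ i + 1) (hx : x ∈ slopeBounded s f)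
    (hmark : (c t).Marks i x) : (c (t + 1)).Marks i x := by
  obtain ⟨hi, p, hp, hxp⟩ := h.exists_dist_le_of_marks hs hst hx hmark
  exact (h.spiked_refines (t + 1)).marks f (h.mem_spiked_U _) i hi s hs
    (hsi.trans ((b (t + 1)).succ_le i hi)) x hx p hp hxp

lemma marks_of_le {t' : ℕ} (ht : t ≤ t') (hs : 0 < s) (hst : s ≤ t) (hsi : s ≤ i + 1)
    (hx : x ∈ slopeBounded s f) (hmark : (c t).Marks i x) : (c t').Marks i x := by
  induction t', ht using Nat.le_induction with
  | base => exact hmark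
  | succ t' htt' ih =>
    refine h.marks_succ hs (hst.trans ?_) hsi hx ih
    exact_mod_cast htt'.trans (h.lt_N t').le

/-- A mark with a large index persists, and only finitely many indices are not large. -/
theorem exists_frequently_marks {m : ℕ} (hx : x ∈ slopeBounded (m + 1) f) :
    ∃ i, ∃ᶠ t in atTop, (c t).Marks i x := by
  by_contra! hrare
  have hm : (0 : ℝ) < m + 1 := by positivity
  obtain ⟨t, hsmall, ht⟩ := (((Set.finite_Iio m).eventually_all.2 fun i _ => hrare i).and
    (eventually_ge_atTop (m + 1))).exists
  have hmt : (m : ℝ) + 1 ≤ t := by exact_mod_cast ht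
  obtain ⟨i, hi⟩ := (h.spiked_refines t).exists_marks f (h.mem_spiked_U t) _ hm
    (hmt.trans (by exact_mod_cast (h.lt_N t).le)) x hx
  have hmi : (m : ℝ) + 1 ≤ i + 1 := by
    have : m ≤ i := by
      by_contra! hlt
      exact hsmall i hlt hi
    gcongr
  obtain ⟨t', hnot, htt'⟩ := ((hrare i).and (eventually_ge_atTop t)).exists
  exact hnot (h.marks_of_le htt' hm hmt hmi hx hi)

theorem mem_of_frequently_marks (hs : 0 < s) (hx : x ∈ slopeBounded s f)
    (hmark : ∃ᶠ t in atTop, (c t).Marks i x) : x ∈ K i := by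
  refine (K i).isClosed.closure_subset (Metric.mem_closure_iff.2 fun ε hε => ?_)
  obtain ⟨t, ⟨hmark, hδ⟩, hst⟩ := ((hmark.and_eventually
    (h.tendsto_δ.eventually_lt_const (by positivity : 0 < ε / 3))).and_eventually
    (eventually_ge_atTop ⌈s⌉₊)).exists
  have hsN : s ≤ (c t).N :=
    (Nat.ceil_le.1 hst).trans (by exact_mod_cast (h.lt_N t).le)
  obtain ⟨hi, p, hp, hxp⟩ := h.exists_dist_le_of_marks hs hsN hx hmark
  obtain ⟨y, hy, hyp⟩ := exists_mem_dist_lt_of_mem_cylinder (h.mem_V (t + 1)) hi hp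
  exact ⟨y, hy, by linarith [dist_triangle_right x y p]⟩

theorem exists_slopeBounded_superset (i : ℕ) : ∃ C > 0, (K i : Set I) ⊆ slopeBounded C f := by
  have hit : i < (b (i + 1)).N := (h.lt_N i).trans_le (h.pinned_refines i).extendedBy.N_le
  set C := (b (i + 1)).e i + 1
  have hC : 0 < C := zero_lt_one.trans_le
    ((b (i + 1)).one_le_slope hit |>.trans SlopeBudget.slope_lt.le)
  refine ⟨C, hC, fun x hx => ?_⟩
  refine (isClosed_slopeBounded C f).closure_subset (Metric.mem_closure_iff.2 fun ε hε => ?_)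
  obtain ⟨t, hδ, ht⟩ := ((h.tendsto_δ.eventually_lt_const (by positivity : 0 < ε / 3)).and
    (eventually_ge_atTop i)).exists
  have hext := h.extendedBy_of_le (Nat.succ_le_succ ht)
  have hi := hit.trans_le hext.N_le
  obtain ⟨p, hp, hxp⟩ := exists_dist_lt_of_mem_cylinder (h.mem_V (t + 1)) hi hx
  obtain ⟨y, hy, hyp⟩ := (b (t + 1)).forced i hi p hp f (h.mem_U _)
  refine ⟨y, slopeBounded_mono (zero_lt_one.trans_le ((b (t + 1)).one_le_slope hi)) ?_ hy, ?_⟩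
  · exact SlopeBudget.slope_lt.le.trans_eq (by rw [hext.e_eq i hit])
  · linarith [dist_triangle_right x y p]

theorem nonKnot_eq_iUnion : nonKnot f = ⋃ n, (K n : Set I) := by
  rw [nonKnot_eq_iUnion_slopeBounded]
  refine subset_antisymm (Set.iUnion_subset fun m x hx => ?_) (Set.iUnion_subset fun i => ?_)
  · obtain ⟨i, hi⟩ := h.exists_frequently_marks hx
    exact Set.mem_iUnion.2 ⟨i, h.mem_of_frequently_marks (by positivity) hx hi⟩
  · obtain ⟨C, hC, hKC⟩ := h.exists_slopeBounded_superset i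
    have hCm : C ≤ ⌈C⌉₊ + 1 := (Nat.le_ceil C).trans (lt_add_one _).le
    exact (hKC.trans (slopeBounded_mono hC hCm)).trans
      (Set.subset_iUnion (fun m : ℕ => slopeBounded (m + 1) f) _)

end IsPlay

/-- The budget without indices. -/
def SlopeBudget.empty : SlopeBudget where
  N := 0
  e _ := 0
  θ := 0
  θ_nonneg := le_rfl
  θ_lt_one := one_pos
  succ_le := by simp

/-- The position admitting all functions and all sequences of closed sets, as a pinned position. -/
def PinnedPosition.start : PinnedPosition :=
  { SlopeBudget.empty with
    F := fun _ => ∅, δ := 1, U := Set.univ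
    isOpen_U := isOpen_univ
    nonempty_U := Set.univ_nonempty
    δ_pos := one_pos
    sep := by simp
    forced := by simp [SlopeBudget.empty] }

/-- A spiked position admitting all sequences of closed sets. -/
noncomputable def SpikedPosition.start : SpikedPosition :=
  { SlopeBudget.empty with
    g := 0, R := 1, A := 1, ω := 1 / 16, r := 1 / 32
    R_pos := one_pos
    A_pos := one_pos
    ω_pos := by norm_num
    r_pos := by norm_num
    ω_le := le_rfl
    r_le := by simp [mesh]
    osc_le := by simp
    ℓ := fun _ => 0
    μ := 1
    μ_pos := one_pos
    resolves := by simp [SpikeGrid.Resolves, SlopeBudget.empty]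
    barrier := fun _ hk => absurd hk (Nat.not_lt_zero _) }

theorem residual_nonKnot_mem {S : Set (Set I)}
    (h : {K : ℕ → Closeds I | (⋃ n, (K n : Set I)) ∈ S} ∈ residual (ℕ → Closeds I)) :
    {f : C(I, ℝ) | nonKnot f ∈ S} ∈ residual C(I, ℝ) := by
  refine mem_of_superset (residual_exists_play PinnedPosition.isOpen_U PinnedPosition.nonempty_U
    SpikedPosition.isOpen_V SpikedPosition.nonempty_V
    (fun _ _ hbc => hbc.V_subset) (fun _ _ hcb => hcb.U_subset)
    (fun _ _ hWb hW hne => PinnedPosition.exists_refinedBy hW hne hWb)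
    (fun _ _ hWc hW hne => SpikedPosition.exists_refinedBy hW hne hWc)
    (b₀ := PinnedPosition.start) rfl h) ?_
  rintro f ⟨K, hK, b, c, -, hplay⟩
  have : IsPlay b c f K := ⟨fun t => (hplay t).1, fun t => (hplay t).2.1,
    fun t => (hplay t).2.2.1, fun t => (hplay t).2.2.2⟩
  rwa [Set.mem_ofPred_eq, this.nonKnot_eq_iUnion]

theorem residual_iUnion_mem {S : Set (Set I)}
    (h : {f : C(I, ℝ) | nonKnot f ∈ S} ∈ residual C(I, ℝ)) :
    {K : ℕ → Closeds I | (⋃ n, (K n : Set I)) ∈ S} ∈ residual (ℕ → Closeds I) := by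
  refine mem_of_superset (residual_exists_play SpikedPosition.isOpen_V SpikedPosition.nonempty_V
    PinnedPosition.isOpen_U PinnedPosition.nonempty_U
    (fun _ _ hcb => hcb.U_subset) (fun _ _ hbc => hbc.V_subset)
    (fun _ _ hWc hW hne => SpikedPosition.exists_refinedBy hW hne hWc)
    (fun _ _ hWb hW hne => PinnedPosition.exists_refinedBy hW hne hWb)
    (b₀ := SpikedPosition.start) ?_ h) ?_
  · exact Set.eq_univ_of_forall fun _ _ hi => absurd hi (Nat.not_lt_zero _)
  rintro K ⟨f, hf, c, b, -, hplay⟩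
  have : IsPlay b (fun t => c (t + 1)) f K := ⟨fun t => (hplay t).2.1,
    fun t => (hplay (t + 1)).1, fun t => (hplay t).2.1.U_subset (hplay (t + 1)).2.2.2,
    fun t => (hplay t).2.1.V_subset (hplay (t + 1)).2.2.1⟩
  rwa [Set.mem_ofPred_eq, ← this.nonKnot_eq_iUnion]

theorem residualFamily_inter_Fsigma {S : Set (Set I)} : ResidualFamily (S ∩ Fsigma) ↔
    {K : ℕ → Closeds I | (⋃ n, (K n : Set I)) ∈ S} ∈ residual (ℕ → Closeds I) := by
  have hFsigma (K : ℕ → Closeds I) : (⋃ n, (K n : Set I)) ∈ Fsigma := ⟨K, rfl⟩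
  simp only [ResidualFamily, Set.mem_inter_iff, hFsigma, and_true]

end KnotPoints

theorem theorem2p4 (S : Set (Set KnotPoints.I)) :
    {f : C(KnotPoints.I, ℝ) | KnotPoints.nonKnot f ∈ S} ∈ residual C(KnotPoints.I, ℝ) ↔
      KnotPoints.ResidualFamily (S ∩ KnotPoints.Fsigma) := by
  rw [KnotPoints.residualFamily_inter_Fsigma]
  exact ⟨KnotPoints.residual_iUnion_mem, KnotPoints.residual_nonKnot_mem⟩
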